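/- **Theorem 2 (Interference upper bound for two users).** Let $N_t\ge 2$, let $B_{\mathrm f},B_{\mathrm c}\ge 0$ be integers and let $\rho\ge 0$. For each of two users $k=1,2$ let the channel $\mathbf h_k\in\mathbb C^{N_t}$ have i.i.d. $\mathcal{CN}(0,1)$ entries, let $\mathcal C_k^{\mathrm c}$ be a channel codebook of $2^{B_{\mathrm c}}$ random vectors, and let $\mathcal C_k^{\mathrm w}$ be a precoder codebook of $2^{B_{\mathrm f}}$ random vectors, where every codeword is a unit-norm, isotropically distributed vector in $\mathbb C^{N_t}$ (its law is invariant under all unitary maps), and all channels and all codewords are mutually independent. Each user shares the quantized channel $\hat{\mathbf h}_k=\|\mathbf h_k\|\hat{\mathbf g}_k^{\mathrm c}$, where $$\hat{\mathbf g}_k^{\mathrm c}\in\arg\max_{\mathbf u\in\mathcal C_k^{\mathrm c}}|\mathbf h_k^{\mathrm H}\mathbf u|,$$ and user $1$ selects the precoder of minimal interference leakage, $$\mathbf w_1^{\mathrm c}\in\arg\min_{\mathbf w\in\mathcal C_1^{\mathrm w}}|\hat{\mathbf h}_2^{\mathrm H}\mathbf w|^2 .$$ Then the interference leakage $I_1^{\mathrm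 c}=\rho|\mathbf h_2^{\mathrm H}\mathbf w_1^{\mathrm c}|^2$ is integrable and its mean over channels and codebooks satisfies $$\mathbb E\{I_1^{\mathrm c}\}\le\frac{\rho N_t}{N_t-1}\left[2^{-B_{\mathrm f}}+\Big(1-\frac{N_t-1}{N_t}2^{-B_{\mathrm f}}\Big)2^{-\frac{B_{\mathrm c}}{N_t-1}}\right].$$ -/

import Mathlib

open MeasureTheory ProbabilityTheory

/-- Column vectors in `ℂ^N` with the Hermitian inner product. In Mathlib, `inner ℂ x y` is
conjugate-linear in `x`, so it is `xᴴ y`. -/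
abbrev CVec (N : ℕ) : Type := EuclideanSpace ℂ (Fin N)

/-- The circularly symmetric complex Gaussian law `CN(0, 1)` on `ℂ`: real and imaginary parts are
independent real Gaussians of mean `0` and variance `1/2`. -/
noncomputable def complexGaussian : Measure ℂ :=
  ((gaussianReal 0 (1 / 2)).prod (gaussianReal 0 (1 / 2))).map (fun p : ℝ × ℝ => ⟨p.1, p.2⟩)

/-- The law `CN(0, I)` on `ℂ^N`: the `N` entries are i.i.d. `CN(0, 1)`. -/
noncomputable def complexGaussianVec (N : ℕ) : Measure (CVec N) :=
  (Measure.pi (fun _ : Fin N => complexGaussian)).map (WithLp.toLp 2)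

/-- `X` is a unit norm isotropically distributed random vector in `ℂ^N`: it has norm one almost
surely, and its law is invariant under every unitary transformation. -/
structure IsIsotropicUnit {Ω : Type*} [MeasurableSpace Ω] (μ : Measure Ω) {N : ℕ}
    (X : Ω → CVec N) : Prop where
  aemeasurable : AEMeasurable X μ
  norm_eq_one : ∀ᵐ ω ∂μ, ‖X ω‖ = 1
  map_unitary : ∀ U : CVec N ≃ₗᵢ[ℂ] CVec N, (μ.map X).map U = μ.map X

/-- The random model with `K` users, `N` transmit antennas and random vector quantization:
user `k` has channel `h k` with law `CN(0, I)`, a channel codebook `Cc k` of `2 ^ Bc` unit norm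
isotropic vectors, and a precoder codebook `Cw k` of `2 ^ Bf` unit norm isotropic vectors. All
channels and all codewords are mutually independent. -/
structure IsRVQModel {Ω : Type*} [MeasurableSpace Ω] (μ : Measure Ω) {K N Bc Bf : ℕ}
    (h : Fin K → Ω → CVec N)
    (Cc : Fin K → Fin (2 ^ Bc) → Ω → CVec N)
    (Cw : Fin K → Fin (2 ^ Bf) → Ω → CVec N) : Prop where
  channel_law : ∀ k, HasLaw (h k) (complexGaussianVec N) μ
  channel_codebook : ∀ k i, IsIsotropicUnit μ (Cc k i)
  precoder_codebook : ∀ k i, IsIsotropicUnit μ (Cw k i)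
  indep : iIndepFun
    (Sum.elim h
      (Sum.elim (fun p : Fin K × Fin (2 ^ Bc) => Cc p.1 p.2)
        (fun p : Fin K × Fin (2 ^ Bf) => Cw p.1 p.2))) μ

/-- `u` is an `argmax` of `|xᴴ u|` over the codebook `C`. -/
def IsQuantizedDirection {N n : ℕ} (C : Fin n → CVec N) (x u : CVec N) : Prop :=
  u ∈ Set.range C ∧ ∀ v ∈ Set.range C, ‖inner ℂ x v‖ ≤ ‖inner ℂ x u‖

/-- The shared channel `ĥ = ‖h‖ ĝ`, where `ĝ` is the quantized direction of `h`. -/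
noncomputable def sharedChannel {N : ℕ} (h g : CVec N) : CVec N := ((‖h‖ : ℝ) : ℂ) • g

/-- The sum `∑_{j ≠ k} |h_jᴴ w|²` of the interference powers that the precoder `w` of user `k`
causes at the other users when their channels are `h`. -/
noncomputable def interference {K N : ℕ} (h : Fin K → CVec N) (k : Fin K) (w : CVec N) : ℝ :=
  ∑ j ∈ Finset.univ.erase k, ‖inner ℂ (h j) w‖ ^ 2

/-- `w` is an `argmin` over the codebook `C` of the interference of user `k`, computed with the
shared channels `hhat`. -/
def IsMinLeakagePrecoder {K N n : ℕ} (C : Fin n → CVec N) (hhat : Fin K → CVec N) (k : Fin K)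
    (w : CVec N) : Prop :=
  w ∈ Set.range C ∧ ∀ v ∈ Set.range C, interference hhat k w ≤ interference hhat k v

/-! Put `m = N - 1`, let `h` be the channel of the victim user, `v` its quantized direction, and `w`
the selected precoder. The selection depends on `v` alone, since the factor `‖h‖` does not move the
argmin. Given `v`, the law of `w` is therefore invariant under all unitaries that fix `v`, and its
second moments are determined by `a = E|vᴴw|²`: the mean of `|hᴴw|²` is `‖h‖² a + (b - a)(‖h‖² -
|hᴴv|²)` with `b = (1 - a)/m`. This is `integral_norm_inner_minCodeword_sq`.

Two means remain. For an isotropic unit vector, `|vᴴx|²` has tail `(1 - t)^m`; this follows by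
comparison with a Gaussian vector. Hence the minimum over `n` codewords has tail `(1 - t)^(m n)`,
and `a = 1/(m n + 1)`. For the quantization error, `(1 - |vᴴx|²)^m` is uniform, its minimum over `n`
codewords has mean `1/(n + 1)`, and Jensen's inequality for the `m`-th power bounds the mean
relative error by `n^(-1/m)`. Since `b ≥ a`, this upper bound may be inserted; averaging `‖h‖²`
gives the factor `N`, and an elementary inequality (`leakage_bound`) loosens the result to the
stated form.

The given selections are arbitrary and need not be measurable. Ties have probability zero, so almost
surely they agree with measurable first-index selections. -/

/-! ### Complex Gaussian laws: tails, moments, unitary invariance. -/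

instance isProbabilityMeasure_complexGaussian : IsProbabilityMeasure complexGaussian := by
  unfold complexGaussian
  exact Measure.isProbabilityMeasure_map
    Complex.measurableEquivRealProd.symm.measurable.aemeasurable

instance isProbabilityMeasure_complexGaussianVec (N : ℕ) :
    IsProbabilityMeasure (complexGaussianVec N) := by
  unfold complexGaussianVec
  exact Measure.isProbabilityMeasure_map (by fun_prop)

lemma complexGaussian_eq_withDensity :
    complexGaussian =
      volume.withDensity (fun z : ℂ => ENNReal.ofReal (Real.pi⁻¹ * Real.exp (-‖z‖ ^ 2))) := by
  have hv : (1 / 2 : NNReal) ≠ 0 := by norm_num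
  have hm : Measurable (fun p : ℝ × ℝ => (⟨p.1, p.2⟩ : ℂ)) :=
    Complex.measurableEquivRealProd.symm.measurable
  ext s hs
  unfold complexGaussian
  rw [Measure.map_apply hm hs, gaussianReal_of_var_ne_zero _ hv,
    prod_withDensity (measurable_gaussianPDF _ _) (measurable_gaussianPDF _ _),
    withDensity_apply _ (hm hs), withDensity_apply _ hs, ← Measure.volume_eq_prod,
    ← Complex.volume_preserving_equiv_real_prod.symm.setLIntegral_comp_preimage_emb
      Complex.measurableEquivRealProd.symm.measurableEmbedding]
  refine setLIntegral_congr_fun (hm hs) fun p _ => ?_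
  change gaussianPDF 0 (1 / 2) p.1 * gaussianPDF 0 (1 / 2) p.2 =
    ENNReal.ofReal (Real.pi⁻¹ * Real.exp (-‖(⟨p.1, p.2⟩ : ℂ)‖ ^ 2))
  rw [gaussianPDF, gaussianPDF, ← ENNReal.ofReal_mul (gaussianPDFReal_nonneg _ _ _)]
  congr 1
  rw [← Complex.normSq_eq_norm_sq, Complex.normSq_mk, gaussianPDFReal_def]
  have h2 : 2 * Real.pi * ((1 / 2 : NNReal) : ℝ) = Real.pi := by push_cast; ring
  have h3 : (2 * ((1 / 2 : NNReal) : ℝ)) = 1 := by push_cast; norm_num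
  simp only [h2, h3]
  have : (√Real.pi)⁻¹ * (√Real.pi)⁻¹ = Real.pi⁻¹ := by
    rw [← mul_inv, Real.mul_self_sqrt Real.pi_pos.le]
  rw [mul_mul_mul_comm, this, ← Real.exp_add]
  congr 2
  ring

/-- In polar coordinates the integrand has an elementary antiderivative. One formula serves twice:
`c = 0` gives the exponential tail of `‖z‖²`, and `t = 0` gives its Laplace transform. -/
lemma setLIntegral_exp_complexGaussian {c t : ℝ} (hc : 0 ≤ c) (ht : 0 ≤ t) :
    ∫⁻ z in {z : ℂ | t < ‖z‖ ^ 2}, ENNReal.ofReal (Real.exp (-c * ‖z‖ ^ 2)) ∂complexGaussian =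
      ENNReal.ofReal (Real.exp (-(1 + c) * t) / (1 + c)) := by
  have hs : MeasurableSet {z : ℂ | t < ‖z‖ ^ 2} :=
    measurableSet_lt measurable_const (by fun_prop)
  rw [complexGaussian_eq_withDensity, setLIntegral_withDensity_eq_setLIntegral_mul _
    (by fun_prop) (by fun_prop) hs, ← lintegral_indicator hs,
    ← Complex.lintegral_comp_polarCoord_symm]
  have hF : ∀ p ∈ polarCoord.target, ENNReal.ofReal p.1 •
      ({z : ℂ | t < ‖z‖ ^ 2}.indicator
        ((fun z : ℂ => ENNReal.ofReal (Real.pi⁻¹ * Real.exp (-‖z‖ ^ 2))) *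
          fun z => ENNReal.ofReal (Real.exp (-c * ‖z‖ ^ 2))) (Complex.polarCoord.symm p)) =
      (Set.Ioi (√t)).indicator
        (fun r => ENNReal.ofReal (r * (Real.pi⁻¹ * Real.exp (-(1 + c) * r ^ 2)))) p.1 := by
    rintro ⟨r, θ⟩ hp
    have hr : 0 < r := by simpa [polarCoord_target] using hp.1
    have hn : ‖(Complex.polarCoord.symm (r, θ))‖ = r := by
      rw [Complex.norm_polarCoord_symm, abs_of_pos hr]
    have hiff : t < r ^ 2 ↔ √t < r := (Real.sqrt_lt' hr).symm
    simp only [Set.indicator_apply, Set.mem_ofPred_eq, hn, hiff, Set.mem_Ioi, Pi.mul_apply]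
    split_ifs with h
    · rw [smul_eq_mul, ← ENNReal.ofReal_mul (by positivity), ← ENNReal.ofReal_mul hr.le,
        mul_assoc, ← Real.exp_add]
      congr 4
      ring
    · simp
  rw [setLIntegral_congr_fun polarCoord.open_target.measurableSet hF, polarCoord_target,
    Measure.volume_eq_prod, ← Measure.prod_restrict]
  have hm : Measurable ((Set.Ioi (√t)).indicator
      (fun r => ENNReal.ofReal (r * (Real.pi⁻¹ * Real.exp (-(1 + c) * r ^ 2))))) :=
    Measurable.indicator (by fun_prop) measurableSet_Ioi
  rw [lintegral_prod _ (by exact (hm.comp measurable_fst).aemeasurable)]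
  simp only [lintegral_const, Measure.restrict_apply MeasurableSet.univ, Set.univ_inter,
    Real.volume_Ioo]
  rw [lintegral_mul_const _ hm, lintegral_indicator measurableSet_Ioi,
    Measure.restrict_restrict measurableSet_Ioi, Set.inter_eq_left.2
      (Set.Ioi_subset_Ioi (Real.sqrt_nonneg t))]
  have hc1 : 0 < 1 + c := by linarith
  -- The `2π` in the denominator cancels the length of the angular interval.
  have hderiv : ∀ r ∈ Set.Ici (√t), HasDerivAt
      (fun r => -(Real.exp (-(1 + c) * r ^ 2) / (2 * Real.pi * (1 + c))))
      (r * (Real.pi⁻¹ * Real.exp (-(1 + c) * r ^ 2))) r := by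
    intro r _
    have h1 : HasDerivAt (fun r : ℝ => -(1 + c) * r ^ 2) (-(1 + c) * (2 * r)) r := by
      simpa using (hasDerivAt_pow 2 r).const_mul (-(1 + c))
    refine (h1.exp.div_const (2 * Real.pi * (1 + c))).neg.congr_deriv ?_
    have := Real.pi_pos.ne'
    have := hc1.ne'
    field_simp
  have hnn : ∀ r ∈ Set.Ioi (√t), 0 ≤ r * (Real.pi⁻¹ * Real.exp (-(1 + c) * r ^ 2)) := by
    intro r hr
    have : 0 < r := (Real.sqrt_nonneg t).trans_lt hr
    positivity
  have hlim : Filter.Tendsto (fun r => -(Real.exp (-(1 + c) * r ^ 2) / (2 * Real.pi * (1 + c))))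
      Filter.atTop (nhds 0) := by
    have h1 : Filter.Tendsto (fun r : ℝ => -(1 + c) * r ^ 2) Filter.atTop Filter.atBot :=
      (Filter.tendsto_pow_atTop two_ne_zero).const_mul_atTop_of_neg (by linarith)
    simpa using ((Real.tendsto_exp_atBot.comp h1).div_const (2 * Real.pi * (1 + c))).neg
  have hint := integrableOn_Ioi_deriv_of_nonneg' hderiv hnn hlim
  rw [← ofReal_integral_eq_lintegral_ofReal hint
    ((ae_restrict_iff' measurableSet_Ioi).2 (Filter.Eventually.of_forall hnn)),
    integral_Ioi_of_hasDerivAt_of_nonneg' hderiv hnn hlim, ← ENNReal.ofReal_mul' (by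
      linarith [Real.pi_pos]), Real.sq_sqrt ht]
  congr 1
  field_simp
  ring

lemma complexGaussian_lt_norm_sq {t : ℝ} (ht : 0 ≤ t) :
    complexGaussian {z : ℂ | t < ‖z‖ ^ 2} = ENNReal.ofReal (Real.exp (-t)) := by
  simpa using setLIntegral_exp_complexGaussian le_rfl ht

lemma lintegral_exp_complexGaussian {c : ℝ} (hc : 0 ≤ c) :
    ∫⁻ z, ENNReal.ofReal (Real.exp (-c * ‖z‖ ^ 2)) ∂complexGaussian =
      ENNReal.ofReal (1 / (1 + c)) := by
  have h := setLIntegral_exp_complexGaussian hc le_rfl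
  have hs : MeasurableSet {z : ℂ | 0 < ‖z‖ ^ 2} :=
    measurableSet_lt measurable_const (by fun_prop)
  rw [Measure.restrict_eq_self_of_ae_mem] at h
  · simpa using h
  · refine (mem_ae_iff_prob_eq_one hs).2 ?_
    rw [complexGaussian_lt_norm_sq le_rfl]
    simp

lemma lintegral_norm_sq_complexGaussian :
    ∫⁻ z, ENNReal.ofReal (‖z‖ ^ 2) ∂complexGaussian = 1 := by
  rw [lintegral_eq_lintegral_meas_lt _ (Filter.Eventually.of_forall fun z => by positivity)
    (by fun_prop), setLIntegral_congr_fun measurableSet_Ioi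
      fun t (ht : 0 < t) => complexGaussian_lt_norm_sq ht.le,
    ← ofReal_integral_eq_lintegral_ofReal (integrableOn_exp_neg_Ioi 0)
      (Filter.Eventually.of_forall fun t => (Real.exp_pos _).le), integral_exp_neg_Ioi_zero,
    ENNReal.ofReal_one]

lemma charFun_complexGaussian (z : ℂ) :
    charFun complexGaussian z = Complex.exp (-(‖z‖ ^ 2 : ℝ) / 4) := by
  have hm : Measurable (fun p : ℝ × ℝ => (⟨p.1, p.2⟩ : ℂ)) :=
    Complex.measurableEquivRealProd.symm.measurable
  rw [charFun_apply, complexGaussian, integral_map hm.aemeasurable (by fun_prop)]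
  have h : ∀ p : ℝ × ℝ, Complex.exp ((inner ℝ (⟨p.1, p.2⟩ : ℂ) z : ℝ) * Complex.I) =
      Complex.exp (z.re * p.1 * Complex.I) * Complex.exp (z.im * p.2 * Complex.I) := by
    intro p
    rw [← Complex.exp_add, Complex.inner]
    congr 1
    simp
    ring
  simp_rw [h]
  rw [integral_prod_mul (fun x : ℝ => Complex.exp (z.re * x * Complex.I))
    (fun y : ℝ => Complex.exp (z.im * y * Complex.I)), ← charFun_apply_real,
    ← charFun_apply_real, charFun_gaussianReal, charFun_gaussianReal, ← Complex.exp_add,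
    ← Complex.normSq_eq_norm_sq, Complex.normSq_apply]
  congr 1
  push_cast
  ring

lemma charFun_complexGaussianVec {N : ℕ} (t : CVec N) :
    charFun (complexGaussianVec N) t = Complex.exp (-(‖t‖ ^ 2 : ℝ) / 4) := by
  rw [complexGaussianVec]
  refine (charFun_pi (μ := fun _ : Fin N => complexGaussian) t).trans ?_
  simp_rw [charFun_complexGaussian, ← Complex.exp_sum, EuclideanSpace.norm_sq_eq]
  congr 1
  push_cast
  rw [← Finset.sum_neg_distrib, Finset.sum_div]

/-- The characteristic function depends only on the norm of its argument. -/
lemma map_complexGaussianVec {N : ℕ} (U : CVec N ≃ₗᵢ[ℂ] CVec N) :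
    (complexGaussianVec N).map U = complexGaussianVec N := by
  have : IsProbabilityMeasure ((complexGaussianVec N).map U) :=
    Measure.isProbabilityMeasure_map (by fun_prop)
  -- `charFun` uses the real inner product, so `U` is viewed as a real isometry.
  let V : CVec N ≃ₗᵢ[ℝ] CVec N :=
    { U.toLinearEquiv.restrictScalars ℝ with norm_map' := U.norm_map }
  refine Measure.ext_of_charFun (funext fun t => ?_)
  have hV : charFun ((complexGaussianVec N).map U) t =
      charFun (complexGaussianVec N) (V.symm t) := by
    rw [charFun_apply, charFun_apply, integral_map (by fun_prop) (by fun_prop)]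
    refine integral_congr_ae (Filter.Eventually.of_forall fun x => ?_)
    have : inner ℝ (U x) t = inner ℝ x (V.symm t) := by
      conv_lhs => rw [← V.apply_symm_apply t]
      exact V.inner_map_map _ _
    simp only [this]
  rw [hV, charFun_complexGaussianVec, charFun_complexGaussianVec, V.symm.norm_map]

lemma lintegral_pi_exp_complexGaussian {c : ℝ} (hc : 0 ≤ c) (m : ℕ) :
    ∫⁻ r : Fin m → ℂ, ENNReal.ofReal (Real.exp (-(c * ∑ i, ‖r i‖ ^ 2)))
      ∂(Measure.pi fun _ => complexGaussian) = ENNReal.ofReal ((1 / (1 + c)) ^ m) := by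
  have hexp : ∀ r : Fin m → ℂ, Real.exp (-(c * ∑ i, ‖r i‖ ^ 2)) =
      ∏ i, Real.exp (-c * ‖r i‖ ^ 2) := by
    intro r
    rw [← Real.exp_sum, ← Finset.mul_sum]
    congr 1
    ring
  have h1 : ∫ z, Real.exp (-c * ‖z‖ ^ 2) ∂complexGaussian = 1 / (1 + c) := by
    rw [integral_eq_lintegral_of_nonneg_ae
      (Filter.Eventually.of_forall fun z => (Real.exp_pos _).le) (by fun_prop),
      lintegral_exp_complexGaussian hc, ENNReal.toReal_ofReal (by positivity)]
  rw [← ofReal_integral_eq_lintegral_ofReal _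
    (Filter.Eventually.of_forall fun r => (Real.exp_pos _).le)]
  · simp_rw [hexp]
    rw [integral_fintype_prod_eq_pow (fun z : ℂ => Real.exp (-c * ‖z‖ ^ 2)), h1,
      Fintype.card_fin]
  · refine Integrable.of_bound (C := 1)
      (Measurable.aestronglyMeasurable (by fun_prop)) (Filter.Eventually.of_forall fun r => ?_)
    rw [Real.norm_of_nonneg (Real.exp_pos _).le, Real.exp_le_one_iff]
    have : 0 ≤ ∑ i, ‖r i‖ ^ 2 := Finset.sum_nonneg fun i _ => by positivity
    nlinarith

/-- Let `R` be the squared norm of the other `m` coordinates. Given `R`, the event is `‖h 0‖² > c R`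
with `c = t/(1 - t)`, of probability `exp(-c R)`. Averaging over `R` gives `(1 + c)^(-m)`, and `1/(1
+ c) = 1 - t`. -/
lemma complexGaussianVec_lt_norm_sq_apply {m : ℕ} {t : ℝ} (ht : 0 ≤ t) (ht1 : t < 1) :
    complexGaussianVec (m + 1) {h | t * ‖h‖ ^ 2 < ‖h 0‖ ^ 2} =
      ENNReal.ofReal ((1 - t) ^ m) := by
  have h1t : 0 < 1 - t := by linarith
  have hS : MeasurableSet {p : ℂ × (Fin m → ℂ) |
      t * (‖p.1‖ ^ 2 + ∑ i, ‖p.2 i‖ ^ 2) < ‖p.1‖ ^ 2} :=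
    measurableSet_lt (by fun_prop) (by fun_prop)
  have hpre : WithLp.toLp 2 ⁻¹' {h : CVec (m + 1) | t * ‖h‖ ^ 2 < ‖h 0‖ ^ 2} =
      MeasurableEquiv.piFinSuccAbove (fun _ => ℂ) 0 ⁻¹' {p : ℂ × (Fin m → ℂ) |
        t * (‖p.1‖ ^ 2 + ∑ i, ‖p.2 i‖ ^ 2) < ‖p.1‖ ^ 2} := by
    ext x
    simp [EuclideanSpace.norm_sq_eq, Fin.sum_univ_succ, Fin.tail]
  rw [complexGaussianVec, Measure.map_apply (by fun_prop)
    (measurableSet_lt (by fun_prop) (by fun_prop)), hpre,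
    (measurePreserving_piFinSuccAbove (fun _ : Fin (m + 1) => complexGaussian) 0).measure_preimage
      hS.nullMeasurableSet, Measure.prod_apply_symm hS]
  have hc : 0 ≤ t / (1 - t) := by positivity
  have hsec : ∀ r : Fin m → ℂ, complexGaussian ((fun z => (z, r)) ⁻¹'
      {p : ℂ × (Fin m → ℂ) | t * (‖p.1‖ ^ 2 + ∑ i, ‖p.2 i‖ ^ 2) < ‖p.1‖ ^ 2}) =
      ENNReal.ofReal (Real.exp (-(t / (1 - t) * ∑ i, ‖r i‖ ^ 2))) := by
    intro r
    have hR : 0 ≤ ∑ i, ‖r i‖ ^ 2 := Finset.sum_nonneg fun i _ => by positivity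
    rw [← complexGaussian_lt_norm_sq (by positivity)]
    congr 1
    ext z
    simp only [Set.mem_preimage, Set.mem_ofPred_eq]
    rw [div_mul_eq_mul_div, div_lt_iff₀ h1t]
    constructor <;> intro h <;> linarith
  simp_rw [hsec]
  rw [lintegral_pi_exp_complexGaussian hc]
  congr 2
  field_simp
  ring

lemma lintegral_norm_sq_complexGaussianVec (N : ℕ) :
    ∫⁻ h, ENNReal.ofReal (‖h‖ ^ 2) ∂complexGaussianVec N = N := by
  rw [complexGaussianVec, lintegral_map (by fun_prop) (by fun_prop)]
  simp_rw [EuclideanSpace.norm_sq_eq]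
  simp_rw [ENNReal.ofReal_sum_of_nonneg (fun i _ => sq_nonneg _)]
  rw [lintegral_finsetSum _ (by fun_prop)]
  have h : ∀ i : Fin N, ∫⁻ x : Fin N → ℂ, ENNReal.ofReal (‖x i‖ ^ 2)
      ∂(Measure.pi fun _ => complexGaussian) = 1 := by
    intro i
    rw [← lintegral_norm_sq_complexGaussian,
      ← (measurePreserving_eval (fun _ : Fin N => complexGaussian) i).lintegral_comp (by fun_prop)]
  simp only [h, Finset.sum_const, Finset.card_univ, Fintype.card_fin, nsmul_eq_mul, mul_one]

lemma ae_ne_zero_complexGaussianVec (m : ℕ) : ∀ᵐ h ∂complexGaussianVec (m + 1), h ≠ 0 := by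
  have h0 := complexGaussianVec_lt_norm_sq_apply (m := m) le_rfl one_pos
  have hmem : {h : CVec (m + 1) | 0 * ‖h‖ ^ 2 < ‖h 0‖ ^ 2} ∈ ae (complexGaussianVec (m + 1)) := by
    refine (mem_ae_iff_prob_eq_one (measurableSet_lt (by fun_prop) (by fun_prop))).2 ?_
    rw [h0]
    simp
  filter_upwards [hmem] with h hh h0
  simp [h0] at hh

/-! ### The law of `|vᴴ x|²` for an isotropic unit vector. -/

/-- The unitary group acts transitively on the unit sphere. -/
lemma exists_unitary_apply_eq {m : ℕ} {u v : CVec (m + 1)} (hu : ‖u‖ = 1) (hv : ‖v‖ = 1) :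
    ∃ U : CVec (m + 1) ≃ₗᵢ[ℂ] CVec (m + 1), U u = v := by
  have key : ∀ x : CVec (m + 1), ‖x‖ = 1 →
      ∃ b : OrthonormalBasis (Fin (m + 1)) ℂ (CVec (m + 1)), b 0 = x := by
    intro x hx
    obtain ⟨b, hb⟩ := Orthonormal.exists_orthonormalBasis_extension_of_card_eq (𝕜 := ℂ)
      (E := CVec (m + 1)) (ι := Fin (m + 1)) (by simp) (v := fun _ => x) (s := {0})
      ⟨fun _ => hx, fun i j hij => absurd (Subsingleton.elim i j) hij⟩
    exact ⟨b, hb 0 rfl⟩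
  obtain ⟨b, rfl⟩ := key u hu
  obtain ⟨b', rfl⟩ := key v hv
  exact ⟨b.equiv b' (Equiv.refl _), by simp⟩

namespace IsIsotropicUnit

variable {N : ℕ} {σ : Measure (CVec N)}

lemma map_eq (hσ : IsIsotropicUnit σ id) (U : CVec N ≃ₗᵢ[ℂ] CVec N) : σ.map U = σ := by
  simpa using hσ.map_unitary U

lemma map_id {Ω : Type*} [MeasurableSpace Ω] {μ : Measure Ω} {X : Ω → CVec N}
    (hX : IsIsotropicUnit μ X) : IsIsotropicUnit (μ.map X) id where
  aemeasurable := aemeasurable_id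
  norm_eq_one := by
    rw [ae_map_iff hX.aemeasurable (measurableSet_eq_fun (by fun_prop) (by fun_prop))]
    exact hX.norm_eq_one
  map_unitary U := by simpa using hX.map_unitary U

lemma measure_lt_norm_inner_sq_congr {m : ℕ} {σ : Measure (CVec (m + 1))}
    (hσ : IsIsotropicUnit σ id) {u v : CVec (m + 1)} (hu : ‖u‖ = 1) (hv : ‖v‖ = 1) (t : ℝ) :
    σ {x | t < ‖inner ℂ u x‖ ^ 2} = σ {x | t < ‖inner ℂ v x‖ ^ 2} := by
  obtain ⟨U, rfl⟩ := exists_unitary_apply_eq hu hv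
  conv_rhs => rw [← hσ.map_eq U]
  rw [Measure.map_apply (by fun_prop) (measurableSet_lt (by fun_prop) (by fun_prop))]
  simp

/-- Draw `h` Gaussian and `x` isotropic independently, and compute the probability of `t ‖h‖² <
|hᴴx|²` in both orders. For fixed `h ≠ 0` it is the wanted tail, which is the same for all unit
directions; for fixed `x`, rotating `x` to a basis vector reduces it to the Gaussian computation. -/
lemma measure_lt_norm_inner_sq_of_lt_one {m : ℕ} {σ : Measure (CVec (m + 1))}
    [IsProbabilityMeasure σ]
    (hσ : IsIsotropicUnit σ id) {v : CVec (m + 1)} (hv : ‖v‖ = 1) {t : ℝ} (ht : 0 ≤ t)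
    (ht1 : t < 1) : σ {x | t < ‖inner ℂ v x‖ ^ 2} = ENNReal.ofReal ((1 - t) ^ m) := by
  have hS : MeasurableSet {p : CVec (m + 1) × CVec (m + 1) |
      t * ‖p.1‖ ^ 2 < ‖inner ℂ p.1 p.2‖ ^ 2} :=
    measurableSet_lt (by fun_prop) (by fun_prop)
  have h1 := Measure.prod_apply (μ := complexGaussianVec (m + 1)) (ν := σ) hS
  have h2 := Measure.prod_apply_symm (μ := complexGaussianVec (m + 1)) (ν := σ) hS
  have e1 : ∀ᵐ h ∂complexGaussianVec (m + 1),
      σ (Prod.mk h ⁻¹' {p : CVec (m + 1) × CVec (m + 1) |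
        t * ‖p.1‖ ^ 2 < ‖inner ℂ p.1 p.2‖ ^ 2}) = σ {x | t < ‖inner ℂ v x‖ ^ 2} := by
    filter_upwards [ae_ne_zero_complexGaussianVec m] with h hh
    have hpos : 0 < ‖h‖ := norm_pos_iff.2 hh
    have hu : ‖((‖h‖⁻¹ : ℝ) : ℂ) • h‖ = 1 := by
      rw [norm_smul, Complex.norm_real, norm_inv, norm_norm, inv_mul_cancel₀ hpos.ne']
    rw [← hσ.measure_lt_norm_inner_sq_congr hu hv t]
    congr 1
    ext x
    simp only [Set.mem_preimage, Set.mem_ofPred_eq]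
    rw [inner_smul_left, norm_mul, RCLike.norm_conj, Complex.norm_real, norm_inv, norm_norm,
      mul_pow, inv_pow, inv_mul_eq_div, lt_div_iff₀ (by positivity)]
  have e2 : ∀ᵐ u ∂σ,
      complexGaussianVec (m + 1) ((fun h => (h, u)) ⁻¹' {p : CVec (m + 1) × CVec (m + 1) |
        t * ‖p.1‖ ^ 2 < ‖inner ℂ p.1 p.2‖ ^ 2}) = ENNReal.ofReal ((1 - t) ^ m) := by
    filter_upwards [hσ.norm_eq_one] with u hu
    obtain ⟨U, hU⟩ := exists_unitary_apply_eq (u := u)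
      (v := EuclideanSpace.single (0 : Fin (m + 1)) (1 : ℂ)) hu (by simp)
    rw [← complexGaussianVec_lt_norm_sq_apply ht ht1]
    conv_rhs => rw [← map_complexGaussianVec U]
    rw [Measure.map_apply (by fun_prop) (measurableSet_lt (by fun_prop) (by fun_prop))]
    congr 1
    ext h
    have h3 : ‖inner ℂ h u‖ = ‖(U h) 0‖ := by
      rw [← U.inner_map_map, hU, EuclideanSpace.inner_single_right]
      simp
    simp [h3]
  rw [lintegral_congr_ae e1] at h1
  rw [lintegral_congr_ae e2] at h2
  simp only [lintegral_const, measure_univ, mul_one] at h1 h2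
  rw [← h1, h2]

lemma ae_norm_inner_sq_le_one {N : ℕ} {σ : Measure (CVec N)}
    (hσ : IsIsotropicUnit σ id) {v : CVec N} (hv : ‖v‖ = 1) :
    ∀ᵐ x ∂σ, ‖inner ℂ v x‖ ^ 2 ≤ 1 := by
  filter_upwards [hσ.norm_eq_one] with x hx
  have := norm_inner_le_norm (𝕜 := ℂ) v x
  rw [hv, show ‖x‖ = 1 from hx] at this
  nlinarith [norm_nonneg (inner ℂ v x)]

lemma measure_lt_norm_inner_sq_of_one_le
    (hσ : IsIsotropicUnit σ id) {v : CVec N} (hv : ‖v‖ = 1) {t : ℝ} (ht : 1 ≤ t) :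
    σ {x | t < ‖inner ℂ v x‖ ^ 2} = 0 := by
  rw [measure_eq_zero_iff_ae_notMem]
  filter_upwards [hσ.ae_norm_inner_sq_le_one hv] with x hx
  exact not_lt.2 (hx.trans ht)

/-- For an isotropic unit vector `x` in `ℂ ^ (m + 1)` and a fixed unit vector `v`, the random
variable `|vᴴ x|²` has the law `Beta(1, m)`. -/
lemma measureReal_lt_norm_inner_sq {m : ℕ} (hm : m ≠ 0) {σ : Measure (CVec (m + 1))}
    [IsProbabilityMeasure σ]
    (hσ : IsIsotropicUnit σ id) {v : CVec (m + 1)} (hv : ‖v‖ = 1) {t : ℝ} (ht : 0 ≤ t)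
    (ht1 : t ≤ 1) : σ.real {x | t < ‖inner ℂ v x‖ ^ 2} = (1 - t) ^ m := by
  rcases ht1.eq_or_lt with rfl | h
  · rw [measureReal_def, hσ.measure_lt_norm_inner_sq_of_one_le hv le_rfl]
    simp [hm]
  · rw [measureReal_def, hσ.measure_lt_norm_inner_sq_of_lt_one hv ht h,
      ENNReal.toReal_ofReal (pow_nonneg (by linarith) _)]

/-- The tail function is continuous, so there are no atoms. For `m = 0` this fails, since the
variable is then almost surely `1`. -/
lemma measure_norm_inner_sq_eq {m : ℕ} (hm : m ≠ 0) {σ : Measure (CVec (m + 1))}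
    [IsProbabilityMeasure σ] (hσ : IsIsotropicUnit σ id) {v : CVec (m + 1)} (hv : ‖v‖ = 1)
    (t : ℝ) : σ {x | ‖inner ℂ v x‖ ^ 2 = t} = 0 := by
  rcases lt_or_ge t 0 with ht | ht
  · convert measure_empty (μ := σ)
    refine Set.eq_empty_of_forall_notMem fun x (hx : _ = t) => ?_
    nlinarith [norm_nonneg (inner ℂ v x)]
  rcases lt_or_ge 1 t with ht1 | ht1
  · rw [measure_eq_zero_iff_ae_notMem]
    filter_upwards [hσ.ae_norm_inner_sq_le_one hv] with x hx
    exact (hx.trans_lt ht1).ne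
  have hms : ∀ s : ℝ, MeasurableSet {x : CVec (m + 1) | s < ‖inner ℂ v x‖ ^ 2} := fun s =>
    measurableSet_lt (by fun_prop) (by fun_prop)
  -- At `t = 0` no admissible `s < t` exists, but the tail at `0` already has full mass.
  rcases ht.eq_or_lt with rfl | ht0
  · have h := (prob_compl_eq_zero_iff (hms 0)).2 (by
      simpa using hσ.measure_lt_norm_inner_sq_of_lt_one hv le_rfl one_pos)
    refine measure_mono_null (fun x (hx : _ = _) => ?_) h
    simp [hx]
  have hle : ∀ᶠ s in nhdsWithin t (Set.Iio t),
      σ.real {x | ‖inner ℂ v x‖ ^ 2 = t} ≤ (1 - s) ^ m - (1 - t) ^ m := by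
    filter_upwards [Ioo_mem_nhdsLT ht0] with s hs
    rw [← hσ.measureReal_lt_norm_inner_sq hm hv hs.1.le (hs.2.le.trans ht1),
      ← hσ.measureReal_lt_norm_inner_sq hm hv ht ht1, le_sub_iff_add_le,
      ← measureReal_union _ (hms t)]
    · refine measureReal_mono ?_
      rintro x (hx | hx)
      · exact hs.2.trans_eq (Eq.symm hx)
      · exact hs.2.trans hx
    · refine Set.disjoint_left.2 fun x (hx : _ = t) (hx' : t < _) => ?_
      rw [hx] at hx'
      exact lt_irrefl _ hx'
  have hlim : Filter.Tendsto (fun s : ℝ => (1 - s) ^ m - (1 - t) ^ m)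
      (nhdsWithin t (Set.Iio t)) (nhds 0) := by
    have : Continuous fun s : ℝ => (1 - s) ^ m - (1 - t) ^ m := by fun_prop
    simpa using (this.tendsto t).mono_left nhdsWithin_le_nhds
  have h0 := ge_of_tendsto hlim hle
  exact (measureReal_eq_zero_iff).1 (le_antisymm h0 measureReal_nonneg)

end IsIsotropicUnit

/-! ### Measurable argmin and the mean of a minimum. -/

/-- Breaking ties by the lowest index makes the minimizer unique, so each fibre of the argmin is cut
out by finitely many inequalities and is measurable. -/
lemma existsUnique_first_argmin {n : ℕ} [NeZero n] (f : Fin n → ℝ) :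
    ∃! j, (∀ k, f j ≤ f k) ∧ ∀ k < j, f j < f k := by
  obtain ⟨i, hi⟩ := Finite.exists_min f
  have hex : ∃ j, ∀ k, f j ≤ f k := ⟨i, hi⟩
  have hwf : WellFounded ((· < ·) : Fin n → Fin n → Prop) := wellFounded_lt
  obtain ⟨j, hj, hmin⟩ := hwf.has_min {j | ∀ k, f j ≤ f k} hex
  refine ⟨j, ⟨hj, fun k hk => lt_of_not_ge fun h => ?_⟩, fun l hl => ?_⟩
  · exact hmin k (fun l => h.trans (hj l)) hk
  · rcases lt_trichotomy l j with h | h | h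
    · exact absurd h (hmin l hl.1)
    · exact h
    · exact absurd (hl.2 j h) (not_lt.2 (hj l))

/-- The first index at which a finite family of real numbers is minimal. -/
noncomputable def argminIdx {n : ℕ} [NeZero n] (f : Fin n → ℝ) : Fin n :=
  (existsUnique_first_argmin f).choose

lemma argminIdx_le {n : ℕ} [NeZero n] (f : Fin n → ℝ) (k : Fin n) : f (argminIdx f) ≤ f k :=
  (existsUnique_first_argmin f).choose_spec.1.1 k

lemma measurable_argminIdx {n : ℕ} [NeZero n] :
    Measurable (argminIdx : (Fin n → ℝ) → Fin n) := by
  refine measurable_to_countable' fun j => ?_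
  have : argminIdx ⁻¹' {j} = {f : Fin n → ℝ | (∀ k, f j ≤ f k) ∧ ∀ k < j, f j < f k} := by
    ext f
    refine ⟨?_, fun h => ?_⟩
    · rintro rfl
      exact (existsUnique_first_argmin f).choose_spec.1
    · exact ((existsUnique_first_argmin f).choose_spec.2 j h).symm
  rw [this]
  have e : {f : Fin n → ℝ | (∀ k, f j ≤ f k) ∧ ∀ k < j, f j < f k} =
      (⋂ k, {f | f j ≤ f k}) ∩ ⋂ k, ⋂ _ : k < j, {f | f j < f k} := by
    ext f
    simp
  rw [e]
  exact (MeasurableSet.iInter fun k => measurableSet_le (by fun_prop) (by fun_prop)).inter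
    (MeasurableSet.iInter fun k => MeasurableSet.iInter fun _ =>
      measurableSet_lt (by fun_prop) (by fun_prop))

lemma measurable_eval_idx {α β : Type*} [MeasurableSpace α] [MeasurableSpace β] {n : ℕ}
    {F : α → Fin n → β} {J : α → Fin n} (hF : Measurable F) (hJ : Measurable J) :
    Measurable fun a => F a (J a) := by
  have h : Measurable fun p : (Fin n → β) × Fin n => p.1 p.2 :=
    measurable_from_prod_countable_left fun j => measurable_pi_apply j
  exact h.comp (hF.prodMk hJ)

lemma ae_pi_forall {ι α : Type*} [Fintype ι] [MeasurableSpace α] {p : ι → Measure α}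
    [∀ i, IsProbabilityMeasure (p i)] {P : α → Prop} (h : ∀ i, ∀ᵐ x ∂p i, P x) :
    ∀ᵐ x ∂Measure.pi p, ∀ i, P (x i) :=
  ae_all_iff.2 fun i => (measurePreserving_eval p i).quasiMeasurePreserving.ae (h i)

/-- The mean of the minimum of `n` independent random variables with the tail `(1 - t) ^ k`
on `[0, 1]`. -/
lemma integral_min_pi {α : Type*} [MeasurableSpace α] {n k : ℕ} {p : Fin n → Measure α}
    [∀ j, IsProbabilityMeasure (p j)] {Y : α → ℝ} {Z : (Fin n → α) → ℝ}
    (hY : ∀ j, ∀ᵐ x ∂p j, Y x ∈ Set.Icc 0 1)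
    (htail : ∀ j, ∀ t ∈ Set.Icc (0 : ℝ) 1, (p j).real {x | t < Y x} = (1 - t) ^ k)
    (hZm : Measurable Z) (hZle : ∀ x j, Z x ≤ Y (x j)) (hZeq : ∀ x, ∃ j, Z x = Y (x j)) :
    ∫ x, Z x ∂Measure.pi p = 1 / ((k : ℝ) * n + 1) := by
  have hZ : ∀ᵐ x ∂Measure.pi p, Z x ∈ Set.Icc 0 1 := by
    filter_upwards [ae_pi_forall hY] with x hx
    obtain ⟨j, hj⟩ := hZeq x
    rw [hj]
    exact hx j
  have hint : Integrable Z (Measure.pi p) := by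
    refine Integrable.of_bound (C := 1) hZm.aestronglyMeasurable ?_
    filter_upwards [hZ] with x hx
    rw [Real.norm_of_nonneg hx.1]
    exact hx.2
  have hset : ∀ t : ℝ, {x | t < Z x} = Set.univ.pi fun _ : Fin n => {x | t < Y x} := by
    intro t
    ext x
    simp only [Set.mem_ofPred_eq, Set.mem_univ_pi]
    refine ⟨fun h j => h.trans_le (hZle x j), fun h => ?_⟩
    obtain ⟨j, hj⟩ := hZeq x
    rw [hj]
    exact h j
  have hin : ∀ t ∈ Set.Ioc (0 : ℝ) 1,
      (Measure.pi p).real {x | t < Z x} = (1 - t) ^ (k * n) := by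
    intro t ht
    rw [hset, measureReal_def, Measure.pi_pi, ENNReal.toReal_prod]
    simp only [← measureReal_def, htail _ t ⟨ht.1.le, ht.2⟩, Finset.prod_const,
      Finset.card_univ, Fintype.card_fin, pow_mul]
  have hout : ∀ t ∈ Set.Ioi (0 : ℝ) \ Set.Ioc 0 1, (Measure.pi p).real {x | t < Z x} = 0 := by
    intro t ht
    have ht1 : 1 < t := by
      by_contra h
      exact ht.2 ⟨ht.1, not_lt.1 h⟩
    rw [measureReal_eq_zero_iff, measure_eq_zero_iff_ae_notMem]
    filter_upwards [hZ] with x hx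
    exact not_lt.2 (hx.2.trans ht1.le)
  rw [hint.integral_eq_integral_meas_lt (hZ.mono fun x hx => hx.1),
    setIntegral_eq_of_subset_of_forall_sdiff_eq_zero measurableSet_Ioi
      Set.Ioc_subset_Ioi_self hout, setIntegral_congr_fun measurableSet_Ioc hin,
    ← intervalIntegral.integral_of_le zero_le_one,
    intervalIntegral.integral_comp_sub_left (fun t => t ^ (k * n)) 1, integral_pow]
  simp

/-! ### Best and worst codeword of a random codebook. -/

namespace IsIsotropicUnit

variable {m n : ℕ}

lemma norm_inner_sq_mem_Icc {N : ℕ} {σ : Measure (CVec N)} (hσ : IsIsotropicUnit σ id)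
    {v : CVec N} (hv : ‖v‖ = 1) : ∀ᵐ x ∂σ, ‖inner ℂ v x‖ ^ 2 ∈ Set.Icc (0 : ℝ) 1 := by
  filter_upwards [hσ.ae_norm_inner_sq_le_one hv] with x hx
  exact ⟨sq_nonneg _, hx⟩

/-- The mean of the minimum of `|vᴴ x|²` over `n` independent isotropic unit vectors `x`. -/
lemma integral_min_norm_inner_sq (hm : m ≠ 0) {σ : Fin n → Measure (CVec (m + 1))}
    [∀ j, IsProbabilityMeasure (σ j)] (hσ : ∀ j, IsIsotropicUnit (σ j) id)
    {v : CVec (m + 1)} (hv : ‖v‖ = 1) {Z : (Fin n → CVec (m + 1)) → ℝ} (hZm : Measurable Z)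
    (hZle : ∀ x j, Z x ≤ ‖inner ℂ v (x j)‖ ^ 2) (hZeq : ∀ x, ∃ j, Z x = ‖inner ℂ v (x j)‖ ^ 2) :
    ∫ x, Z x ∂Measure.pi σ = 1 / ((m : ℝ) * n + 1) :=
  integral_min_pi (Y := fun x => ‖inner ℂ v x‖ ^ 2) (fun j => (hσ j).norm_inner_sq_mem_Icc hv)
    (fun j _ ht => (hσ j).measureReal_lt_norm_inner_sq hm hv ht.1 ht.2) hZm hZle hZeq

/-- `(1 - |vᴴ x|²) ^ m` is uniformly distributed on `[0, 1]`. -/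
lemma measureReal_lt_one_sub_pow (hm : m ≠ 0) {σ : Measure (CVec (m + 1))}
    [IsProbabilityMeasure σ] (hσ : IsIsotropicUnit σ id) {v : CVec (m + 1)} (hv : ‖v‖ = 1)
    {t : ℝ} (ht : t ∈ Set.Icc (0 : ℝ) 1) :
    σ.real {x | t < (1 - ‖inner ℂ v x‖ ^ 2) ^ m} = 1 - t := by
  obtain ⟨s, hs0, hs1, rfl⟩ : ∃ s : ℝ, 0 ≤ s ∧ s ≤ 1 ∧ s ^ m = t := by
    refine ⟨t ^ ((m : ℝ)⁻¹), Real.rpow_nonneg ht.1 _, Real.rpow_le_one ht.1 ht.2 (by positivity),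
      Real.rpow_inv_natCast_pow ht.1 hm⟩
  have hms : MeasurableSet {x : CVec (m + 1) | 1 - s < ‖inner ℂ v x‖ ^ 2} :=
    measurableSet_lt (by fun_prop) (by fun_prop)
  have hne : ∀ᵐ x ∂σ, ‖inner ℂ v x‖ ^ 2 ≠ 1 - s :=
    measure_eq_zero_iff_ae_notMem.1 (hσ.measure_norm_inner_sq_eq hm hv (1 - s))
  -- Passing to the complement turns a strict inequality into a weak one; the difference is a level
  -- set, which is null.
  have heq : ({x | s ^ m < (1 - ‖inner ℂ v x‖ ^ 2) ^ m} : Set (CVec (m + 1))) =ᵐ[σ]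
      ({x | 1 - s < ‖inner ℂ v x‖ ^ 2}ᶜ : Set (CVec (m + 1))) := by
    filter_upwards [hσ.ae_norm_inner_sq_le_one hv, hne] with x hx hx'
    have h1 : s ^ m < (1 - ‖inner ℂ v x‖ ^ 2) ^ m ↔ s < 1 - ‖inner ℂ v x‖ ^ 2 :=
      pow_lt_pow_iff_left₀ hs0 (by linarith) hm
    refine propext (h1.trans ?_)
    change _ ↔ ¬ (1 - s < _)
    rw [not_lt]
    refine ⟨fun h => by linarith, fun h => ?_⟩
    have := lt_of_le_of_ne h hx'
    linarith
  rw [measureReal_congr heq, probReal_compl_eq_one_sub hms,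
    hσ.measureReal_lt_norm_inner_sq hm hv (by linarith) (by linarith), sub_sub_cancel]

/-- The mean quantization error of a random codebook of `n` isotropic unit vectors. -/
lemma integral_one_sub_max_norm_inner_sq_le (hm : m ≠ 0) {σ : Fin n → Measure (CVec (m + 1))}
    [∀ j, IsProbabilityMeasure (σ j)] (hσ : ∀ j, IsIsotropicUnit (σ j) id)
    {v : CVec (m + 1)} (hv : ‖v‖ = 1) {Z : (Fin n → CVec (m + 1)) → ℝ} (hn : n ≠ 0)
    (hZm : Measurable Z)
    (hZle : ∀ x j, ‖inner ℂ v (x j)‖ ^ 2 ≤ Z x) (hZeq : ∀ x, ∃ j, Z x = ‖inner ℂ v (x j)‖ ^ 2) :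
    ∫ x, (1 - Z x) ∂Measure.pi σ ≤ (n : ℝ) ^ (-(1 / (m : ℝ))) := by
  have hZ : ∀ᵐ x ∂Measure.pi σ, 0 ≤ Z x ∧ ∀ j, ‖inner ℂ v (x j)‖ ^ 2 ≤ 1 := by
    filter_upwards [ae_pi_forall fun j => (hσ j).ae_norm_inner_sq_le_one hv] with x hx
    obtain ⟨j, hj⟩ := hZeq x
    exact ⟨hj ▸ sq_nonneg _, hx⟩
  have hZ1 : ∀ᵐ x ∂Measure.pi σ, 0 ≤ 1 - Z x ∧ 1 - Z x ≤ 1 := by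
    filter_upwards [hZ] with x hx
    obtain ⟨j, hj⟩ := hZeq x
    refine ⟨?_, by linarith [hx.1]⟩
    rw [hj]
    linarith [hx.2 j]
  -- `integral_min_pi` needs its comparison at every point, while `1 - Z` is nonnegative only almost
  -- surely; truncating at `0` keeps the `m`-th power monotone everywhere.
  let W : (Fin n → CVec (m + 1)) → ℝ := fun x => max (1 - Z x) 0 ^ m
  let Y : CVec (m + 1) → ℝ := fun x => max (1 - ‖inner ℂ v x‖ ^ 2) 0 ^ m
  have hW : ∫ x, W x ∂Measure.pi σ = 1 / (((1 : ℕ) : ℝ) * n + 1) := by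
    refine integral_min_pi (Y := Y) ?_ ?_ (by fun_prop) ?_ ?_
    · intro j
      filter_upwards [(hσ j).norm_inner_sq_mem_Icc hv] with x hx
      exact ⟨by positivity, pow_le_one₀ (by positivity) (max_le (by linarith [hx.1]) zero_le_one)⟩
    · intro j t ht
      rw [pow_one, ← (hσ j).measureReal_lt_one_sub_pow hm hv ht]
      refine measureReal_congr ?_
      filter_upwards [(hσ j).ae_norm_inner_sq_le_one hv] with x hx
      change (t < max (1 - ‖inner ℂ v x‖ ^ 2) 0 ^ m) = (t < (1 - ‖inner ℂ v x‖ ^ 2) ^ m)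
      rw [max_eq_left (by linarith)]
    · intro x j
      refine pow_le_pow_left₀ (le_max_right _ _) (max_le_max ?_ le_rfl) _
      linarith [hZle x j]
    · intro x
      obtain ⟨j, hj⟩ := hZeq x
      exact ⟨j, by simp only [W, Y, hj]⟩
  have hWeq : ∀ᵐ x ∂Measure.pi σ, (1 - Z x) ^ m = W x := by
    filter_upwards [hZ1] with x hx
    simp only [W, max_eq_left hx.1]
  have hi1 : Integrable (fun x => 1 - Z x) (Measure.pi σ) := by
    refine Integrable.of_bound (C := 1) (Measurable.aestronglyMeasurable (by fun_prop)) ?_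
    filter_upwards [hZ1] with x hx
    rw [Real.norm_of_nonneg hx.1]
    exact hx.2
  have hi2 : Integrable (fun x => (1 - Z x) ^ m) (Measure.pi σ) := by
    refine Integrable.of_bound (C := 1) (Measurable.aestronglyMeasurable (by fun_prop)) ?_
    filter_upwards [hZ1] with x hx
    rw [Real.norm_of_nonneg (pow_nonneg hx.1 _)]
    exact pow_le_one₀ hx.1 hx.2
  -- Jensen: the `m`-th power of the mean error is at most the mean of a minimum of `n` uniform
  -- variables, `1/(n + 1) ≤ 1/n`.
  have hJ := (convexOn_pow m).map_integral_le (f := fun x => 1 - Z x) (μ := Measure.pi σ)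
    (by fun_prop) isClosed_Ici (hZ1.mono fun x hx => hx.1) hi1 hi2
  rw [integral_congr_ae hWeq, hW] at hJ
  have hn0 : (0 : ℝ) < n := by positivity
  have h0 : 0 ≤ ∫ x, (1 - Z x) ∂Measure.pi σ := integral_nonneg_of_ae (hZ1.mono fun x hx => hx.1)
  have hpow : (∫ x, (1 - Z x) ∂Measure.pi σ) ^ m ≤ (n : ℝ)⁻¹ := by
    refine hJ.trans ?_
    rw [one_div]
    exact inv_anti₀ hn0 (by push_cast; linarith)
  calc ∫ x, (1 - Z x) ∂Measure.pi σ
      = ((∫ x, (1 - Z x) ∂Measure.pi σ) ^ m) ^ ((m : ℝ)⁻¹) := (Real.pow_rpow_inv_natCast h0 hm).symm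
    _ ≤ ((n : ℝ)⁻¹) ^ ((m : ℝ)⁻¹) :=
      Real.rpow_le_rpow (pow_nonneg h0 _) hpow (by positivity)
    _ = (n : ℝ) ^ (-(1 / (m : ℝ))) := by
      rw [Real.inv_rpow hn0.le, Real.rpow_neg hn0.le, one_div]

end IsIsotropicUnit

/-! ### Second moments of a law invariant under the stabilizer of `v`. -/

section SecondMoment

variable {m : ℕ} {ν : Measure (CVec (m + 1))} {v : CVec (m + 1)}

lemma integrable_norm_inner_sq {N : ℕ} {ν : Measure (CVec N)} [IsProbabilityMeasure ν]
    (hν : ∀ᵐ w ∂ν, ‖w‖ = 1) (x : CVec N) :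
    Integrable (fun w => ‖inner ℂ x w‖ ^ 2) ν := by
  refine Integrable.of_bound (C := ‖x‖ ^ 2) (Measurable.aestronglyMeasurable (by fun_prop)) ?_
  filter_upwards [hν] with w hw
  rw [Real.norm_of_nonneg (sq_nonneg _)]
  refine pow_le_pow_left₀ (norm_nonneg _) ?_ 2
  simpa [hw] using norm_inner_le_norm (𝕜 := ℂ) x w

lemma integral_norm_inner_sq_map_apply (hinv : ∀ U : CVec (m + 1) ≃ₗᵢ[ℂ] CVec (m + 1),
    U v = v → ν.map U = ν) {U : CVec (m + 1) ≃ₗᵢ[ℂ] CVec (m + 1)} (hU : U v = v)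
    (x : CVec (m + 1)) :
    ∫ w, ‖inner ℂ (U x) w‖ ^ 2 ∂ν = ∫ w, ‖inner ℂ x w‖ ^ 2 ∂ν := by
  conv_lhs => rw [← hinv U hU]
  rw [integral_map (by fun_prop) (Measurable.aestronglyMeasurable (by fun_prop))]
  simp

lemma integral_norm_inner_sq_smul (c : ℂ) (x : CVec (m + 1)) :
    ∫ w, ‖inner ℂ (c • x) w‖ ^ 2 ∂ν = ‖c‖ ^ 2 * ∫ w, ‖inner ℂ x w‖ ^ 2 ∂ν := by
  simp_rw [inner_smul_left, norm_mul, RCLike.norm_conj, mul_pow]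
  rw [integral_const_mul]

/-- `U` carries `p + r` to `p - r`, so both have the same second moment; the parallelogram law then
removes the cross term. -/
lemma integral_norm_inner_sq_add_of_neg [IsProbabilityMeasure ν]
    (hν : ∀ᵐ w ∂ν, ‖w‖ = 1)
    (hinv : ∀ U : CVec (m + 1) ≃ₗᵢ[ℂ] CVec (m + 1), U v = v → ν.map U = ν) {p r : CVec (m + 1)}
    {U : CVec (m + 1) ≃ₗᵢ[ℂ] CVec (m + 1)} (hU : U v = v) (hp : U p = p) (hr : U r = -r) :
    ∫ w, ‖inner ℂ (p + r) w‖ ^ 2 ∂ν =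
      ∫ w, ‖inner ℂ p w‖ ^ 2 ∂ν + ∫ w, ‖inner ℂ r w‖ ^ 2 ∂ν := by
  have h1 := integral_norm_inner_sq_map_apply hinv hU (p + r)
  rw [map_add, hp, hr, ← sub_eq_add_neg] at h1
  have h2 : ∫ w, (‖inner ℂ (p + r) w‖ ^ 2 + ‖inner ℂ (p - r) w‖ ^ 2) ∂ν =
      ∫ w, 2 * (‖inner ℂ p w‖ ^ 2 + ‖inner ℂ r w‖ ^ 2) ∂ν := by
    refine integral_congr_ae (Filter.Eventually.of_forall fun w => ?_)
    have := parallelogram_law_with_norm ℂ (inner ℂ p w) (inner ℂ r w)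
    simp only [inner_add_left, inner_sub_left]
    nlinarith
  rw [integral_add (integrable_norm_inner_sq hν _) (integrable_norm_inner_sq hν _),
    integral_const_mul, integral_add (integrable_norm_inner_sq hν _)
      (integrable_norm_inner_sq hν _), h1] at h2
  linarith

/-- Extend `v, s` to an orthonormal basis. Swapping basis vectors other than `v` is a unitary fixing
`v`, so the `m` directions orthogonal to `v` have equal second moments, and by Parseval all of them
sum to `1`. -/
lemma integral_norm_inner_sq_of_orthogonal [IsProbabilityMeasure ν]
    (hm : m ≠ 0) (hν : ∀ᵐ w ∂ν, ‖w‖ = 1)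
    (hinv : ∀ U : CVec (m + 1) ≃ₗᵢ[ℂ] CVec (m + 1), U v = v → ν.map U = ν)
    {s : CVec (m + 1)} (hv : ‖v‖ = 1) (hs : ‖s‖ = 1) (hvs : inner ℂ v s = 0) :
    ∫ w, ‖inner ℂ s w‖ ^ 2 ∂ν = (1 - ∫ w, ‖inner ℂ v w‖ ^ 2 ∂ν) / m := by
  have h0l : (0 : Fin (m + 1)) ≠ Fin.last m := by
    rw [Ne, Fin.ext_iff]
    simpa using hm.symm
  have horth : Orthonormal ℂ (({0, Fin.last m} : Set (Fin (m + 1))).domRestrict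
      fun i => if i = 0 then v else s) := by
    refine ⟨?_, ?_⟩
    · rintro ⟨i, hi⟩
      simp only [Set.domRestrict_apply]
      split_ifs <;> assumption
    · rintro ⟨i, rfl | rfl⟩ ⟨j, rfl | rfl⟩ hij
      · exact absurd rfl hij
      · simpa [h0l.symm] using hvs
      · simpa [h0l.symm] using inner_eq_zero_symm.1 hvs
      · exact absurd rfl hij
  obtain ⟨b, hb⟩ := horth.exists_orthonormalBasis_extension_of_card_eq (by simp)
  have hb0 : b 0 = v := by simpa using hb 0 (by simp)
  have hbl : b (Fin.last m) = s := by simpa [h0l.symm] using hb (Fin.last m) (by simp)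
  have hj : ∀ j : Fin m, ∫ w, ‖inner ℂ (b j.succ) w‖ ^ 2 ∂ν = ∫ w, ‖inner ℂ s w‖ ^ 2 ∂ν := by
    intro j
    have hU : b.equiv b (Equiv.swap j.succ (Fin.last m)) v = v := by
      rw [← hb0, OrthonormalBasis.equiv_apply_basis,
        Equiv.swap_apply_of_ne_of_ne (Fin.succ_ne_zero j).symm h0l]
    rw [← integral_norm_inner_sq_map_apply hinv hU, OrthonormalBasis.equiv_apply_basis,
      Equiv.swap_apply_left, hbl]
  have hsum : ∑ j, ∫ w, ‖inner ℂ (b j) w‖ ^ 2 ∂ν = 1 := by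
    rw [← integral_finsetSum _ fun j _ => integrable_norm_inner_sq hν _]
    simp_rw [b.sum_sq_norm_inner_right]
    have : ∀ᵐ w ∂ν, ‖w‖ ^ 2 = (1 : ℝ) := hν.mono fun w hw => by rw [hw, one_pow]
    rw [integral_congr_ae this]
    simp
  rw [Fin.sum_univ_succ, hb0] at hsum
  simp_rw [hj] at hsum
  have hm' : (m : ℝ) ≠ 0 := by exact_mod_cast hm
  rw [eq_div_iff hm', ← hsum]
  simp
  ring

/-- The second moments of a random unit vector whose law is invariant under the unitary maps that
fix the unit vector `v`. -/
lemma integral_norm_inner_sq_of_invariant [IsProbabilityMeasure ν]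
    (hm : m ≠ 0) (hν : ∀ᵐ w ∂ν, ‖w‖ = 1)
    (hinv : ∀ U : CVec (m + 1) ≃ₗᵢ[ℂ] CVec (m + 1), U v = v → ν.map U = ν)
    (hv : ‖v‖ = 1) (x : CVec (m + 1)) :
    ∫ w, ‖inner ℂ x w‖ ^ 2 ∂ν = ‖inner ℂ v x‖ ^ 2 * ∫ w, ‖inner ℂ v w‖ ^ 2 ∂ν +
      (‖x‖ ^ 2 - ‖inner ℂ v x‖ ^ 2) * ((1 - ∫ w, ‖inner ℂ v w‖ ^ 2 ∂ν) / m) := by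
  set c : ℂ := inner ℂ v x
  set r := x - c • v with hr
  have hvr : inner ℂ v r = 0 := by
    rw [hr, inner_sub_right, inner_smul_right, inner_self_eq_norm_sq_to_K, hv]
    simp [c]
  have hx : x = c • v + r := by rw [hr]; abel
  have hnorm : ‖r‖ ^ 2 = ‖x‖ ^ 2 - ‖c‖ ^ 2 := by
    have h := norm_add_sq_eq_norm_sq_add_norm_sq_of_inner_eq_zero (𝕜 := ℂ) (c • v) r
      (by rw [inner_smul_left, hvr, mul_zero])
    rw [← hx, norm_smul, hv] at h
    nlinarith
  -- This reflection fixes `v` and negates `r`, so the components of `x` along and across `v`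
  -- contribute separately.
  let U := (ℂ ∙ v).reflection
  have hUv : U v = v := Submodule.reflection_mem_subspace_eq_self
    (Submodule.mem_span_singleton_self v)
  have hUr : U r = -r := Submodule.reflection_mem_subspace_orthogonalComplement_eq_neg
    (Submodule.mem_orthogonal_singleton_iff_inner_right.2 hvr)
  have hq := integral_norm_inner_sq_add_of_neg hν hinv hUv
    (p := c • v) (by rw [map_smul, hUv]) hUr
  rw [← hx, integral_norm_inner_sq_smul] at hq
  rw [hq, ← hnorm]
  congr 1
  by_cases hr0 : r = 0
  · simp [hr0]
  · have hpos : 0 < ‖r‖ := norm_pos_iff.2 hr0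
    have hrs : r = ((‖r‖ : ℝ) : ℂ) • (((‖r‖⁻¹ : ℝ) : ℂ) • r) := by
      rw [smul_smul, ← Complex.ofReal_mul, mul_inv_cancel₀ hpos.ne', Complex.ofReal_one, one_smul]
    have hs : ‖((‖r‖⁻¹ : ℝ) : ℂ) • r‖ = 1 := by
      rw [norm_smul, Complex.norm_real, norm_inv, norm_norm, inv_mul_cancel₀ hpos.ne']
    rw [← integral_norm_inner_sq_of_orthogonal hm hν hinv hv hs
      (by rw [inner_smul_right, hvr, mul_zero])]
    conv_lhs => rw [hrs]
    rw [integral_norm_inner_sq_smul, Complex.norm_real, norm_norm]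

end SecondMoment

/-! ### Measurable selections and their agreement with arbitrary ones. -/

section Selection

variable {N n : ℕ} [NeZero n]

/-- The first codeword `u` of `c` that maximizes `|hᴴ u|`. -/
noncomputable def maxCodeword (h : CVec N) (c : Fin n → CVec N) : CVec N :=
  c (argminIdx fun i => -‖inner ℂ h (c i)‖)

/-- The first codeword `u` of `c` that minimizes `|vᴴ u|`. -/
noncomputable def minCodeword (v : CVec N) (c : Fin n → CVec N) : CVec N :=
  c (argminIdx fun i => ‖inner ℂ v (c i)‖)

lemma measurable_maxCodeword :
    Measurable fun p : CVec N × (Fin n → CVec N) => maxCodeword p.1 p.2 :=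
  measurable_eval_idx measurable_snd (measurable_argminIdx.comp
    (measurable_pi_lambda _ fun i => by fun_prop))

lemma measurable_minCodeword :
    Measurable fun p : CVec N × (Fin n → CVec N) => minCodeword p.1 p.2 :=
  measurable_eval_idx measurable_snd (measurable_argminIdx.comp
    (measurable_pi_lambda _ fun i => by fun_prop))

lemma norm_inner_le_maxCodeword (h : CVec N) (c : Fin n → CVec N) (i : Fin n) :
    ‖inner ℂ h (c i)‖ ≤ ‖inner ℂ h (maxCodeword h c)‖ :=
  neg_le_neg_iff.1 (argminIdx_le (fun i => -‖inner ℂ h (c i)‖) i)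

lemma norm_inner_minCodeword_le (v : CVec N) (c : Fin n → CVec N) (i : Fin n) :
    ‖inner ℂ v (minCodeword v c)‖ ≤ ‖inner ℂ v (c i)‖ :=
  argminIdx_le (fun i => ‖inner ℂ v (c i)‖) i

lemma eq_maxCodeword {h u : CVec N} {c : Fin n → CVec N}
    (hinj : ∀ i j, i ≠ j → ‖inner ℂ h (c i)‖ ≠ ‖inner ℂ h (c j)‖)
    (hu : IsQuantizedDirection c h u) : u = maxCodeword h c := by
  obtain ⟨⟨i, rfl⟩, hmax⟩ := hu
  by_contra hne
  exact hinj i (argminIdx fun i => -‖inner ℂ h (c i)‖) (fun hi => hne (congrArg c hi))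
    (le_antisymm (norm_inner_le_maxCodeword h c i) (hmax _ ⟨_, rfl⟩))

lemma interference_zero {N : ℕ} (h : Fin 2 → CVec N) (w : CVec N) :
    interference h 0 w = ‖inner ℂ (h 1) w‖ ^ 2 := by
  have : Finset.univ.erase (0 : Fin 2) = {1} := rfl
  rw [interference, this, Finset.sum_singleton]

/-- The positive factor `‖h 1‖` cancels from the comparison, so only the direction `g 1` matters;
without ties its minimizer is unique. -/
lemma eq_minCodeword {h g : Fin 2 → CVec N} {w : CVec N} {c : Fin n → CVec N} (hh : h 1 ≠ 0)
    (hinj : ∀ i j, i ≠ j → ‖inner ℂ (g 1) (c i)‖ ≠ ‖inner ℂ (g 1) (c j)‖)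
    (hw : IsMinLeakagePrecoder c (fun j => sharedChannel (h j) (g j)) 0 w) :
    w = minCodeword (g 1) c := by
  obtain ⟨⟨i, rfl⟩, hmin⟩ := hw
  by_contra hne
  refine hinj i (argminIdx fun i => ‖inner ℂ (g 1) (c i)‖) (fun hi => hne (congrArg c hi))
    (le_antisymm ?_ (norm_inner_minCodeword_le (g 1) c i))
  have hle := hmin (c (argminIdx fun i => ‖inner ℂ (g 1) (c i)‖)) ⟨_, rfl⟩
  have hpos : 0 < ‖h 1‖ := norm_pos_iff.2 hh
  rw [interference_zero, interference_zero, sharedChannel, inner_smul_left, inner_smul_left,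
    norm_mul, norm_mul, RCLike.norm_conj, Complex.norm_real, norm_norm] at hle
  have h2 := (pow_le_pow_iff_left₀ (by positivity) (by positivity) two_ne_zero).1 hle
  exact le_of_mul_le_mul_left h2 hpos

end Selection

/-! ### Absence of ties; leakage conditional on the quantized direction. -/

namespace IsIsotropicUnit

variable {m n : ℕ} {σ : Fin n → Measure (CVec (m + 1))} [∀ j, IsProbabilityMeasure (σ j)]

lemma measure_norm_inner_eq (hm : m ≠ 0) {σ : Measure (CVec (m + 1))} [IsProbabilityMeasure σ]
    (hσ : IsIsotropicUnit σ id) {v : CVec (m + 1)} (hv : v ≠ 0) (t : ℝ) :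
    σ {x | t = ‖inner ℂ v x‖} = 0 := by
  have hpos : 0 < ‖v‖ := norm_pos_iff.2 hv
  have he : ‖((‖v‖⁻¹ : ℝ) : ℂ) • v‖ = 1 := by
    rw [norm_smul, Complex.norm_real, norm_inv, norm_norm, inv_mul_cancel₀ hpos.ne']
  refine measure_mono_null (fun x (hx : t = _) => ?_)
    (hσ.measure_norm_inner_sq_eq hm he ((‖v‖⁻¹ * t) ^ 2))
  change _ = _
  rw [inner_smul_left, norm_mul, RCLike.norm_conj, Complex.norm_real, norm_inv, norm_norm, hx]

/-- Two distinct codewords are independent: with one fixed, a tie would place the other on a null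
level set. -/
lemma ae_pi_norm_inner_ne (hm : m ≠ 0) (hσ : ∀ j, IsIsotropicUnit (σ j) id)
    {v : CVec (m + 1)} (hv : v ≠ 0) :
    ∀ᵐ x ∂Measure.pi σ, ∀ i j, i ≠ j → ‖inner ℂ v (x i)‖ ≠ ‖inner ℂ v (x j)‖ := by
  refine ae_all_iff.2 fun i => ae_all_iff.2 fun j => ?_
  by_cases hij : i = j
  · exact Filter.Eventually.of_forall fun x h => absurd hij h
  have hind := (iIndepFun_pi (μ := σ) (X := fun _ x => x) fun i => aemeasurable_id).indepFun hij
  have hmap := (indepFun_iff_map_prod_eq_prod_map_map (measurable_pi_apply i).aemeasurable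
    (measurable_pi_apply j).aemeasurable).1 hind
  rw [(measurePreserving_eval σ i).map_eq, (measurePreserving_eval σ j).map_eq] at hmap
  have hS : MeasurableSet {p : CVec (m + 1) × CVec (m + 1) |
      ‖inner ℂ v p.1‖ = ‖inner ℂ v p.2‖} :=
    measurableSet_eq_fun (by fun_prop) (by fun_prop)
  have h0 : ((σ i).prod (σ j)) {p | ‖inner ℂ v p.1‖ = ‖inner ℂ v p.2‖} = 0 :=
    (Measure.measure_prod_null hS).2 (Filter.Eventually.of_forall fun x =>
      (hσ j).measure_norm_inner_eq hm hv ‖inner ℂ v x‖)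
  rw [← hmap, Measure.map_apply (by fun_prop) hS] at h0
  filter_upwards [measure_eq_zero_iff_ae_notMem.1 h0] with x hx _
  exact hx

variable [NeZero n]

/-- Applying `U` to every codeword preserves the codebook law and, as `U` fixes `v`, every inner
product with `v`. The selected index is unchanged, so selection commutes with `U`. -/
lemma map_minCodeword (hσ : ∀ j, IsIsotropicUnit (σ j) id) {v : CVec (m + 1)}
    {U : CVec (m + 1) ≃ₗᵢ[ℂ] CVec (m + 1)} (hU : U v = v) :
    ((Measure.pi σ).map (minCodeword v)).map U = (Measure.pi σ).map (minCodeword v) := by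
  have hmeas : Measurable (minCodeword v : (Fin n → CVec (m + 1)) → CVec (m + 1)) :=
    measurable_minCodeword.comp measurable_prodMk_left
  have hpi : (Measure.pi σ).map (fun x j => U (x j)) = Measure.pi σ := by
    have : ∀ j, IsProbabilityMeasure ((σ j).map U) := fun j =>
      Measure.isProbabilityMeasure_map (by fun_prop)
    rw [Measure.pi_map_pi (fun j => by fun_prop)]
    exact congrArg _ (funext fun j => (hσ j).map_eq U)
  conv_rhs => rw [← hpi]
  rw [Measure.map_map (by fun_prop) hmeas, Measure.map_map hmeas
    (measurable_pi_lambda _ fun j => by fun_prop)]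
  congr 1
  funext x
  have h : ∀ j, inner ℂ v (U (x j)) = inner ℂ v (x j) := fun j => by
    conv_lhs => rw [← hU]
    exact U.inner_map_map _ _
  simp only [Function.comp_apply, minCodeword, h]

/-- The mean leakage of the precoder selected for the direction `v`, at a receiver with
channel `x`. -/
lemma integral_norm_inner_minCodeword_sq (hm : m ≠ 0) (hσ : ∀ j, IsIsotropicUnit (σ j) id)
    {v : CVec (m + 1)} (hv : ‖v‖ = 1) (x : CVec (m + 1)) :
    ∫ w, ‖inner ℂ x (minCodeword v w)‖ ^ 2 ∂Measure.pi σ =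
      ‖inner ℂ v x‖ ^ 2 * (1 / ((m : ℝ) * n + 1)) +
      (‖x‖ ^ 2 - ‖inner ℂ v x‖ ^ 2) * ((1 - 1 / ((m : ℝ) * n + 1)) / m) := by
  have hmeas : Measurable (minCodeword v : (Fin n → CVec (m + 1)) → CVec (m + 1)) :=
    measurable_minCodeword.comp measurable_prodMk_left
  have : IsProbabilityMeasure ((Measure.pi σ).map (minCodeword v)) :=
    Measure.isProbabilityMeasure_map hmeas.aemeasurable
  have hunit : ∀ᵐ w ∂(Measure.pi σ).map (minCodeword v), ‖w‖ = 1 := by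
    rw [ae_map_iff hmeas.aemeasurable (measurableSet_eq_fun (by fun_prop) (by fun_prop))]
    filter_upwards [ae_pi_forall fun j => (hσ j).norm_eq_one] with w hw
    exact hw _
  have hq : ∀ y : CVec (m + 1), ∫ w, ‖inner ℂ y w‖ ^ 2 ∂(Measure.pi σ).map (minCodeword v) =
      ∫ w, ‖inner ℂ y (minCodeword v w)‖ ^ 2 ∂Measure.pi σ := fun y =>
    integral_map hmeas.aemeasurable (Measurable.aestronglyMeasurable (by fun_prop))
  have ha : ∫ w, ‖inner ℂ v (minCodeword v w)‖ ^ 2 ∂Measure.pi σ = 1 / ((m : ℝ) * n + 1) :=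
    integral_min_norm_inner_sq hm hσ hv (by fun_prop)
      (fun w j => pow_le_pow_left₀ (norm_nonneg _) (norm_inner_minCodeword_le v w j) 2)
      (fun w => ⟨_, rfl⟩)
  rw [← hq, integral_norm_inner_sq_of_invariant hm hunit (fun U hU => map_minCodeword hσ hU) hv,
    hq, ha]

lemma integral_norm_sq_sub_maxCodeword_le (hm : m ≠ 0) (hσ : ∀ j, IsIsotropicUnit (σ j) id)
    (h : CVec (m + 1)) :
    ∫ c, (‖h‖ ^ 2 - ‖inner ℂ h (maxCodeword h c)‖ ^ 2) ∂Measure.pi σ ≤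
      ‖h‖ ^ 2 * (n : ℝ) ^ (-(1 / (m : ℝ))) := by
  rcases eq_or_ne h 0 with rfl | hh
  · simp
  have hmeas : Measurable (maxCodeword h : (Fin n → CVec (m + 1)) → CVec (m + 1)) :=
    measurable_maxCodeword.comp measurable_prodMk_left
  have hpos : 0 < ‖h‖ := norm_pos_iff.2 hh
  have he : ‖((‖h‖⁻¹ : ℝ) : ℂ) • h‖ = 1 := by
    rw [norm_smul, Complex.norm_real, norm_inv, norm_norm, inv_mul_cancel₀ hpos.ne']
  have hs : ∀ y, ‖inner ℂ (((‖h‖⁻¹ : ℝ) : ℂ) • h) y‖ ^ 2 = (‖h‖⁻¹ * ‖inner ℂ h y‖) ^ 2 := by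
    intro y
    rw [inner_smul_left, norm_mul, RCLike.norm_conj, Complex.norm_real, norm_inv, norm_norm]
  have key := integral_one_sub_max_norm_inner_sq_le (σ := σ) hm hσ he
    (Z := fun c => (‖h‖⁻¹ * ‖inner ℂ h (maxCodeword h c)‖) ^ 2) (NeZero.ne n) (by fun_prop)
    (fun c j => by
      rw [hs]
      have := norm_inner_le_maxCodeword h c j
      gcongr)
    (fun c => ⟨_, (hs _).symm⟩)
  have heq : ∀ c : Fin n → CVec (m + 1), ‖h‖ ^ 2 - ‖inner ℂ h (maxCodeword h c)‖ ^ 2 =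
      ‖h‖ ^ 2 * (1 - (‖h‖⁻¹ * ‖inner ℂ h (maxCodeword h c)‖) ^ 2) := by
    intro c
    field_simp
  simp_rw [heq]
  rw [integral_const_mul]
  gcongr

end IsIsotropicUnit

/-! ### Averaging the leakage over codebooks and channel. -/

lemma integrable_norm_sq_complexGaussianVec (N : ℕ) :
    Integrable (fun h => ‖h‖ ^ 2) (complexGaussianVec N) := by
  refine ⟨Measurable.aestronglyMeasurable (by fun_prop), ?_⟩
  rw [hasFiniteIntegral_iff_ofReal (Filter.Eventually.of_forall fun h => sq_nonneg _),
    lintegral_norm_sq_complexGaussianVec]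
  exact ENNReal.natCast_lt_top N

lemma integral_norm_sq_complexGaussianVec (N : ℕ) :
    ∫ h, ‖h‖ ^ 2 ∂complexGaussianVec N = N := by
  rw [integral_eq_lintegral_of_nonneg_ae (Filter.Eventually.of_forall fun h => sq_nonneg _)
    (Measurable.aestronglyMeasurable (by fun_prop)), lintegral_norm_sq_complexGaussianVec,
    ENNReal.toReal_natCast]

/-- The interference power at a receiver with channel `p.1`, whose quantized direction is taken
from the codebook `p.2.1`, when the precoder is selected from the codebook `p.2.2`. -/
noncomputable def leakage {N nc nf : ℕ} [NeZero nc] [NeZero nf]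
    (p : CVec N × (Fin nc → CVec N) × (Fin nf → CVec N)) : ℝ :=
  ‖inner ℂ p.1 (minCodeword (maxCodeword p.1 p.2.1) p.2.2)‖ ^ 2

section Leakage

variable {m nc nf : ℕ} [NeZero nc]

lemma measurable_leakage [NeZero nf] {N : ℕ} :
    Measurable (leakage : CVec N × (Fin nc → CVec N) × (Fin nf → CVec N) → ℝ) := by
  have h1 : Measurable fun p : CVec N × (Fin nc → CVec N) × (Fin nf → CVec N) =>
      maxCodeword p.1 p.2.1 :=
    measurable_maxCodeword.comp (measurable_fst.prodMk (measurable_fst.comp measurable_snd))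
  have h2 : Measurable fun p : CVec N × (Fin nc → CVec N) × (Fin nf → CVec N) =>
      minCodeword (maxCodeword p.1 p.2.1) p.2.2 :=
    measurable_minCodeword.comp (h1.prodMk (measurable_snd.comp measurable_snd))
  unfold leakage
  fun_prop

lemma leakage_le [NeZero nf] {N : ℕ} {p : CVec N × (Fin nc → CVec N) × (Fin nf → CVec N)}
    (hp : ∀ j, ‖p.2.2 j‖ = 1) : ‖leakage p‖ ≤ ‖p.1‖ ^ 2 := by
  rw [leakage, Real.norm_of_nonneg (sq_nonneg _)]
  refine pow_le_pow_left₀ (norm_nonneg _) ?_ 2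
  have := norm_inner_le_norm (𝕜 := ℂ) p.1 (minCodeword (maxCodeword p.1 p.2.1) p.2.2)
  rwa [show ‖minCodeword (maxCodeword p.1 p.2.1) p.2.2‖ = 1 from hp _, mul_one] at this

variable {τ : Fin nc → Measure (CVec (m + 1))} {σ : Fin nf → Measure (CVec (m + 1))}
  [∀ i, IsProbabilityMeasure (τ i)] [∀ j, IsProbabilityMeasure (σ j)]

lemma integrable_leakage [NeZero nf] (hσ : ∀ j, IsIsotropicUnit (σ j) id) :
    Integrable leakage ((complexGaussianVec (m + 1)).prod
      ((Measure.pi τ).prod (Measure.pi σ))) := by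
  refine ((integrable_norm_sq_complexGaussianVec (m + 1)).comp_fst
    ((Measure.pi τ).prod (Measure.pi σ))).mono' measurable_leakage.aestronglyMeasurable ?_
  have h1 : ∀ᵐ w ∂Measure.pi σ, ∀ j, ‖w j‖ = 1 := ae_pi_forall fun j => (hσ j).norm_eq_one
  have h2 := (Measure.quasiMeasurePreserving_snd (μ := complexGaussianVec (m + 1))
    (ν := (Measure.pi τ).prod (Measure.pi σ))).ae
      ((Measure.quasiMeasurePreserving_snd (μ := Measure.pi τ) (ν := Measure.pi σ)).ae h1)
  filter_upwards [h2] with p hp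
  exact leakage_le hp

lemma integral_leakage_channel_le [NeZero nf] (hm : m ≠ 0) (hτ : ∀ i, IsIsotropicUnit (τ i) id)
    (hσ : ∀ j, IsIsotropicUnit (σ j) id) (h : CVec (m + 1)) :
    ∫ p, leakage (h, p) ∂(Measure.pi τ).prod (Measure.pi σ) ≤
      ‖h‖ ^ 2 * (1 / ((m : ℝ) * nf + 1) + ((1 - 1 / ((m : ℝ) * nf + 1)) / m -
        1 / ((m : ℝ) * nf + 1)) * (nc : ℝ) ^ (-(1 / (m : ℝ)))) := by
  set a : ℝ := 1 / ((m : ℝ) * nf + 1) with ha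
  set b : ℝ := (1 - a) / m
  have hm0 : (0 : ℝ) < m := by positivity
  have hnf : (1 : ℝ) ≤ nf := by exact_mod_cast NeZero.one_le
  -- Here `b - a = (nf - 1)/(m nf + 1)`. Its sign is what allows an upper bound on the quantization
  -- error to be used.
  have hba : 0 ≤ b - a := by
    have : b = nf / ((m : ℝ) * nf + 1) := by
      simp only [b, ha]
      field_simp
      ring
    rw [this, ha, ← sub_div]
    exact div_nonneg (by linarith) (by positivity)
  have hσ1 : ∀ᵐ w ∂Measure.pi σ, ∀ j, ‖w j‖ = 1 := ae_pi_forall fun j => (hσ j).norm_eq_one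
  have hτ1 : ∀ᵐ c ∂Measure.pi τ, ∀ i, ‖c i‖ = 1 := ae_pi_forall fun i => (hτ i).norm_eq_one
  have hint : Integrable (fun p => leakage (h, p)) ((Measure.pi τ).prod (Measure.pi σ)) := by
    refine Integrable.of_bound (C := ‖h‖ ^ 2)
      (measurable_leakage.comp measurable_prodMk_left).aestronglyMeasurable ?_
    filter_upwards [(Measure.quasiMeasurePreserving_snd (μ := Measure.pi τ)
      (ν := Measure.pi σ)).ae hσ1] with p hp
    exact leakage_le (p := (h, p)) hp
  have hmeas : Measurable (maxCodeword h : (Fin nc → CVec (m + 1)) → CVec (m + 1)) :=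
    measurable_maxCodeword.comp measurable_prodMk_left
  have hinner : ∀ᵐ c ∂Measure.pi τ, ∫ w, leakage (h, c, w) ∂Measure.pi σ =
      ‖h‖ ^ 2 * a + (b - a) * (‖h‖ ^ 2 - ‖inner ℂ h (maxCodeword h c)‖ ^ 2) := by
    filter_upwards [hτ1] with c hc
    have := IsIsotropicUnit.integral_norm_inner_minCodeword_sq hm hσ
      (v := maxCodeword h c) (hc _) h
    simp only [leakage]
    rw [this, norm_inner_symm, ← ha]
    ring
  have hint2 : Integrable (fun c => ‖h‖ ^ 2 - ‖inner ℂ h (maxCodeword h c)‖ ^ 2)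
      (Measure.pi τ) := by
    refine Integrable.of_bound (C := ‖h‖ ^ 2) (Measurable.aestronglyMeasurable (by fun_prop)) ?_
    filter_upwards [hτ1] with c hc
    have h1 := norm_inner_le_norm (𝕜 := ℂ) h (maxCodeword h c)
    rw [show ‖maxCodeword h c‖ = 1 from hc _, mul_one] at h1
    have h2 := pow_le_pow_left₀ (norm_nonneg _) h1 2
    rw [Real.norm_of_nonneg (sub_nonneg.2 h2)]
    exact sub_le_self _ (sq_nonneg _)
  have hq := IsIsotropicUnit.integral_norm_sq_sub_maxCodeword_le hm hτ h
  rw [integral_prod _ hint, integral_congr_ae hinner, integral_add (integrable_const _)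
    (hint2.const_mul _), integral_const_mul (b - a)]
  simp only [integral_const, probReal_univ, one_smul]
  nlinarith [mul_le_mul_of_nonneg_left hq hba]

lemma integral_leakage_le [NeZero nf] (hm : m ≠ 0) (hτ : ∀ i, IsIsotropicUnit (τ i) id)
    (hσ : ∀ j, IsIsotropicUnit (σ j) id) :
    ∫ p, leakage p ∂(complexGaussianVec (m + 1)).prod ((Measure.pi τ).prod (Measure.pi σ)) ≤
      (m + 1) * (1 / ((m : ℝ) * nf + 1) + ((1 - 1 / ((m : ℝ) * nf + 1)) / m -
        1 / ((m : ℝ) * nf + 1)) * (nc : ℝ) ^ (-(1 / (m : ℝ)))) := by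
  have hint := integrable_leakage (τ := τ) hσ
  rw [integral_prod _ hint]
  refine (integral_mono hint.integral_prod_left
    ((integrable_norm_sq_complexGaussianVec (m + 1)).mul_const _)
    (integral_leakage_channel_le hm hτ hσ)).trans_eq ?_
  rw [integral_mul_const, integral_norm_sq_complexGaussianVec]
  push_cast
  rfl

/-- Almost surely neither the quantization nor the precoder selection has a tie. -/
lemma ae_prod_no_tie (hm : m ≠ 0) (hτ : ∀ i, IsIsotropicUnit (τ i) id)
    (hσ : ∀ j, IsIsotropicUnit (σ j) id) :
    ∀ᵐ p ∂(complexGaussianVec (m + 1)).prod ((Measure.pi τ).prod (Measure.pi σ)), p.1 ≠ 0 ∧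
      (∀ i j, i ≠ j → ‖inner ℂ p.1 (p.2.1 i)‖ ≠ ‖inner ℂ p.1 (p.2.1 j)‖) ∧
      ∀ i j, i ≠ j → ‖inner ℂ (maxCodeword p.1 p.2.1) (p.2.2 i)‖ ≠
        ‖inner ℂ (maxCodeword p.1 p.2.1) (p.2.2 j)‖ := by
  -- Measurability of the tie-free set lets the claim be checked successively in channel, channel
  -- codebook and precoder codebook.
  have hne : ∀ {α : Type} [MeasurableSpace α] {k : ℕ} {f : α → Fin k → ℝ},
      (∀ i, Measurable fun x => f x i) →
      MeasurableSet {x | ∀ i j, i ≠ j → f x i ≠ f x j} := by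
    intro α _ k f hf
    have : {x | ∀ i j, i ≠ j → f x i ≠ f x j} =
        ⋂ i, ⋂ j, ⋂ _ : i ≠ j, {x | f x i = f x j}ᶜ := by
      ext x
      simp
    rw [this]
    exact MeasurableSet.iInter fun i => MeasurableSet.iInter fun j => MeasurableSet.iInter fun _ =>
      (measurableSet_eq_fun (hf i) (hf j)).compl
  have hmax : Measurable fun p : CVec (m + 1) × (Fin nc → CVec (m + 1)) ×
      (Fin nf → CVec (m + 1)) => maxCodeword p.1 p.2.1 :=
    measurable_maxCodeword.comp (measurable_fst.prodMk (measurable_fst.comp measurable_snd))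
  have hmeas : MeasurableSet {p : CVec (m + 1) × (Fin nc → CVec (m + 1)) ×
      (Fin nf → CVec (m + 1)) | p.1 ≠ 0 ∧
      (∀ i j, i ≠ j → ‖inner ℂ p.1 (p.2.1 i)‖ ≠ ‖inner ℂ p.1 (p.2.1 j)‖) ∧
      ∀ i j, i ≠ j → ‖inner ℂ (maxCodeword p.1 p.2.1) (p.2.2 i)‖ ≠
        ‖inner ℂ (maxCodeword p.1 p.2.1) (p.2.2 j)‖} :=
    (measurableSet_eq_fun measurable_fst measurable_const).compl.inter
      ((hne fun i => by fun_prop).inter (hne fun i => by fun_prop))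
  rw [Measure.ae_prod_iff_ae_ae hmeas]
  filter_upwards [ae_ne_zero_complexGaussianVec m] with h hh
  refine (Measure.ae_prod_iff_ae_ae (measurable_prodMk_left hmeas)).2 ?_
  filter_upwards [IsIsotropicUnit.ae_pi_norm_inner_ne hm hτ hh,
    ae_pi_forall fun i => (hτ i).norm_eq_one] with c hc hc1
  have hv : maxCodeword h c ≠ 0 := by
    rw [← norm_pos_iff, show ‖maxCodeword h c‖ = 1 from hc1 _]
    exact one_pos
  filter_upwards [IsIsotropicUnit.ae_pi_norm_inner_ne hm hσ hv] with w hw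
  exact ⟨hh, hc, hw⟩

end Leakage

/-! ### Final inequality, joint law of the model, and conclusion. -/

/-- Both coefficients are bounded termwise. The first replaces `m n + 1` by `m n`; in the second the
difference has numerator `n (2 m + 1) - m`, nonnegative because `n ≥ 1`. -/
lemma leakage_bound {m nc nf : ℕ} (hm : m ≠ 0) (hf : nf ≠ 0) :
    ((m : ℝ) + 1) * (1 / ((m : ℝ) * nf + 1) + ((1 - 1 / ((m : ℝ) * nf + 1)) / m -
        1 / ((m : ℝ) * nf + 1)) * (nc : ℝ) ^ (-(1 / (m : ℝ)))) ≤
      (m + 1) / m * ((nf : ℝ)⁻¹ + (1 - m / (m + 1) * (nf : ℝ)⁻¹) *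
        (nc : ℝ) ^ (-(1 / (m : ℝ)))) := by
  have hm0 : (0 : ℝ) < m := by positivity
  have hn0 : (0 : ℝ) < nf := by positivity
  have hn1 : (1 : ℝ) ≤ nf := by exact_mod_cast Nat.one_le_iff_ne_zero.2 hf
  have hD : (0 : ℝ) ≤ (nc : ℝ) ^ (-(1 / (m : ℝ))) := by positivity
  generalize (nc : ℝ) ^ (-(1 / (m : ℝ))) = D at hD
  generalize (nf : ℝ) = n at *
  generalize (m : ℝ) = x at *
  have h1 : 1 / (x * n + 1) ≤ 1 / x * n⁻¹ := by
    rw [one_div_mul_eq_div, inv_div_left, one_div]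
    exact inv_anti₀ (by positivity) (by linarith)
  have h2 : (1 - 1 / (x * n + 1)) / x - 1 / (x * n + 1) ≤
      1 / x * (1 - x / (x + 1) * n⁻¹) := by
    rw [← sub_nonneg]
    have : 1 / x * (1 - x / (x + 1) * n⁻¹) - ((1 - 1 / (x * n + 1)) / x - 1 / (x * n + 1)) =
        (n * (2 * x + 1) - x) / (x * (x + 1) * n * (x * n + 1)) := by
      field_simp
      ring
    rw [this]
    have : 0 ≤ n * (2 * x + 1) - x := by nlinarith
    positivity
  calc _ ≤ (x + 1) * (1 / x * n⁻¹ + 1 / x * (1 - x / (x + 1) * n⁻¹) * D) := by gcongr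
    _ = _ := by ring

lemma IsRVQModel.map_eq {Ω : Type*} [MeasurableSpace Ω] {μ : Measure Ω} [IsProbabilityMeasure μ]
    {N Bc Bf : ℕ} {h : Fin 2 → Ω → CVec N} {Cc : Fin 2 → Fin (2 ^ Bc) → Ω → CVec N}
    {Cw : Fin 2 → Fin (2 ^ Bf) → Ω → CVec N} (hmodel : IsRVQModel μ h Cc Cw) :
    μ.map (fun ω => (h 1 ω, (fun i => Cc 1 i ω), fun j => Cw 0 j ω)) =
      (complexGaussianVec N).prod ((Measure.pi fun i => μ.map (Cc 1 i)).prod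
        (Measure.pi fun j => μ.map (Cw 0 j))) := by
  -- Only the second user's channel and channel codebook and the first user's precoder codebook
  -- enter the leakage; an injective reindexing extracts them and keeps independence.
  let e : Unit ⊕ (Fin (2 ^ Bc) ⊕ Fin (2 ^ Bf)) →
      Fin 2 ⊕ (Fin 2 × Fin (2 ^ Bc) ⊕ Fin 2 × Fin (2 ^ Bf)) :=
    Sum.map (fun _ => 1) (Sum.map (Prod.mk 1) (Prod.mk 0))
  have he : Function.Injective e :=
    (Function.injective_of_subsingleton _).sumMap
      ((Prod.mk_right_injective 1).sumMap (Prod.mk_right_injective 0))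
  have hind := hmodel.indep.precomp he
  let f : Unit ⊕ (Fin (2 ^ Bc) ⊕ Fin (2 ^ Bf)) → Ω → CVec N :=
    Sum.elim (fun _ => h 1) (Sum.elim (fun i => Cc 1 i) (fun j => Cw 0 j))
  have hfe : ∀ i, (Sum.elim h (Sum.elim (fun p : Fin 2 × Fin (2 ^ Bc) => Cc p.1 p.2)
      (fun p : Fin 2 × Fin (2 ^ Bf) => Cw p.1 p.2))) (e i) = f i := by
    rintro (i | i | i) <;> rfl
  simp only [hfe] at hind
  have hfm : ∀ i, AEMeasurable (f i) μ := by
    rintro (i | i | i)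
    · exact (hmodel.channel_law 1).aemeasurable
    · exact (hmodel.channel_codebook 1 i).aemeasurable
    · exact (hmodel.precoder_codebook 0 i).aemeasurable
  have hprob : ∀ i, IsProbabilityMeasure (μ.map (f i)) := fun i =>
    Measure.isProbabilityMeasure_map (hfm i)
  have hmap := (iIndepFun_iff_map_fun_eq_pi_map hfm).1 hind
  have hT := ((measurePreserving_eval (fun _ : Unit => μ.map (f (Sum.inl ()))) ()).prod
    (measurePreserving_sumPiEquivProdPi (X := fun _ => CVec N)
      (fun i : Fin (2 ^ Bc) ⊕ Fin (2 ^ Bf) => μ.map (f (Sum.inr i))))).comp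
    (measurePreserving_sumPiEquivProdPi (X := fun _ => CVec N) (fun i => μ.map (f i)))
  have h2 := hT.map_eq
  rw [← hmap, AEMeasurable.map_map_of_aemeasurable hT.measurable.aemeasurable
    (aemeasurable_pi_lambda _ hfm)] at h2
  rw [← (hmodel.channel_law 1).map_eq]
  exact h2

theorem theorem2 {Ω : Type*} [MeasurableSpace Ω] (μ : Measure Ω) [IsProbabilityMeasure μ]
    (N Bc Bf : ℕ) (hN : 2 ≤ N) (ρ : ℝ) (hρ : 0 ≤ ρ)
    (h : Fin 2 → Ω → CVec N)
    (Cc : Fin 2 → Fin (2 ^ Bc) → Ω → CVec N)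
    (Cw : Fin 2 → Fin (2 ^ Bf) → Ω → CVec N)
    (hmodel : IsRVQModel μ h Cc Cw)
    (g : Fin 2 → Ω → CVec N)
    (hg : ∀ k ω, IsQuantizedDirection (fun i => Cc k i ω) (h k ω) (g k ω))
    (w : Ω → CVec N)
    (hw : ∀ ω, IsMinLeakagePrecoder (fun i => Cw 0 i ω)
      (fun j => sharedChannel (h j ω) (g j ω)) 0 (w ω)) :
    Integrable (fun ω => ρ * interference (fun j => h j ω) 0 (w ω)) μ ∧
    ∫ ω, ρ * interference (fun j => h j ω) 0 (w ω) ∂μ ≤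
      ρ * (N : ℝ) / ((N : ℝ) - 1) *
        ((2 : ℝ) ^ (-(Bf : ℝ)) +
          (1 - ((N : ℝ) - 1) / (N : ℝ) * (2 : ℝ) ^ (-(Bf : ℝ))) *
            (2 : ℝ) ^ (-(Bc : ℝ) / ((N : ℝ) - 1))) := by
  obtain ⟨m, rfl⟩ : ∃ m, N = m + 1 := ⟨N - 1, by omega⟩
  have hm : m ≠ 0 := by omega
  have hτp : ∀ i, IsProbabilityMeasure (μ.map (Cc 1 i)) := fun i =>
    Measure.isProbabilityMeasure_map (hmodel.channel_codebook 1 i).aemeasurable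
  have hσp : ∀ j, IsProbabilityMeasure (μ.map (Cw 0 j)) := fun j =>
    Measure.isProbabilityMeasure_map (hmodel.precoder_codebook 0 j).aemeasurable
  have hτ : ∀ i, IsIsotropicUnit (μ.map (Cc 1 i)) id := fun i =>
    (hmodel.channel_codebook 1 i).map_id
  have hσ : ∀ j, IsIsotropicUnit (μ.map (Cw 0 j)) id := fun j =>
    (hmodel.precoder_codebook 0 j).map_id
  set X : Ω → CVec (m + 1) × (Fin (2 ^ Bc) → CVec (m + 1)) × (Fin (2 ^ Bf) → CVec (m + 1)) :=
    fun ω => (h 1 ω, (fun i => Cc 1 i ω), fun j => Cw 0 j ω) with hX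
  have hXm : AEMeasurable X μ :=
    (hmodel.channel_law 1).aemeasurable.prodMk
      ((aemeasurable_pi_lambda _ fun i => (hmodel.channel_codebook 1 i).aemeasurable).prodMk
        (aemeasurable_pi_lambda _ fun j => (hmodel.precoder_codebook 0 j).aemeasurable))
  have hmap := hmodel.map_eq
  rw [← hX] at hmap
  have htie := ae_prod_no_tie hm hτ hσ
  have hint := integrable_leakage (τ := fun i => μ.map (Cc 1 i)) hσ
  have hle := integral_leakage_le hm hτ hσ
  rw [← hmap] at htie hint hle
  rw [integral_map hXm measurable_leakage.aestronglyMeasurable] at hle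
  -- Off the null set of ties, `g 1` and `w` are forced to be the measurable selections, so no
  -- measurability of `g` or `w` is needed.
  have heq : ∀ᵐ ω ∂μ, interference (fun j => h j ω) 0 (w ω) = leakage (X ω) := by
    filter_upwards [ae_of_ae_map hXm htie] with ω hω
    obtain ⟨h0, hc, hw'⟩ := hω
    have hgω := eq_maxCodeword hc (hg 1 ω)
    rw [← show g 1 ω = maxCodeword (X ω).1 (X ω).2.1 from hgω] at hw'
    have hwω := eq_minCodeword (g := fun j => g j ω) h0 hw' (hw ω)
    rw [interference_zero, hwω]
    simp only [leakage]
    rw [hgω]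
  have hintω : Integrable (fun ω => leakage (X ω)) μ := hint.comp_aemeasurable hXm
  refine ⟨(hintω.const_mul ρ).congr (heq.mono fun ω hω => by simp only [hω]), ?_⟩
  rw [integral_const_mul, integral_congr_ae heq]
  have hb := hle.trans (leakage_bound (nc := 2 ^ Bc) (nf := 2 ^ Bf) hm (by positivity))
  have hf : (((2 ^ Bf : ℕ) : ℝ))⁻¹ = (2 : ℝ) ^ (-(Bf : ℝ)) := by
    rw [Real.rpow_neg zero_le_two, Real.rpow_natCast]
    push_cast
    rfl
  have hc : ((2 ^ Bc : ℕ) : ℝ) ^ (-(1 / (m : ℝ))) = (2 : ℝ) ^ (-(Bc : ℝ) / (m : ℝ)) := by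
    push_cast
    rw [← Real.rpow_natCast, ← Real.rpow_mul zero_le_two]
    congr 1
    ring
  rw [hf, hc] at hb
  push_cast
  rw [add_sub_cancel_right]
  refine (mul_le_mul_of_nonneg_left hb hρ).trans_eq ?_
  ring
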